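/- Let $P_a>0$ and $\sigma^2>0$. For every $K\ge 1$ let $M=M(K)>K$ be an integer, let $\mathbf h_1,\dots,\mathbf h_K\sim\mathcal{CN}(\mathbf 0,\mathbf I_M)$ be independent (the channels of $K$ users, uncorrelated case $\mathbf R=\mathbf I_M$), $\mathbf H=[\mathbf h_1,\dots,\mathbf h_K]$, and let the data vector $\mathbf u\sim\mathcal{CN}(\mathbf 0,\mathbf I_K)$ be independent of $\mathbf H$; nothing is assumed on the joint law for different $K$. Let $\gamma=\gamma_K$ be deterministic design parameters, bounded away from $0$ and $\infty$ (for example, constant). Let $\mathbf x$ be any solution of $$\min_{\mathbf x\in\mathbb C^M}\ \|\mathbf H^{\mathsf H}\mathbf x-\sqrt{\gamma}\,\mathbf u\|^2\quad\text{subject to}\quad \mathbf x^{\mathsf H}\mathbf x\le P_a ,$$ and put $$\mathrm{SINR}_K=\frac{\gamma\,\mathbf u^{\mathsf H}\mathbf u}{\|\mathbf H^{\mathsf H}\mathbf x-\sqrt{\gamma}\,\mathbf u\|^2+K\sigma^2}.$$ For $c\in(0,1)$ and $\rho\ge 0$ let $$m(\rho)=m_c(\rho)=\frac{-2}{1-\frac1c-\rho-\sqrt{\left(1-\frac1c+\rho\right)^2+\frac{4\rho}{c}}},\qquad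 \bar f(\rho)=\bar f_c(\rho)=m(\rho)+\rho\, m'(\rho),$$ $$\overline{\mathrm{SINR}}(\rho)=\overline{\mathrm{SINR}}_c(\rho)=\frac{1}{-\rho^2m'(\rho)+\frac{\sigma^2}{P_a}\bar f(\rho)} .$$ (i) Let $c=c_K=K/M$ and suppose that for all large $K$ the number $\bar\rho=\bar\rho_K\ge 0$ satisfies $\gamma_K\,\bar f_{c_K}(\bar\rho_K)=P_a$. Then, almost surely, $\mathrm{SINR}_K-\overline{\mathrm{SINR}}_{c_K}(\bar\rho_K)\to 0$ as $K\to\infty$. (ii) For every $c\in(0,1)$ and $\gamma>0$, the equation $\gamma\bar f_c(\bar\rho)=P_a$ has a solution $\bar\rho\ge0$ if and only if $\gamma\ge P_a\left(\frac1c-1\right)$, and the solution is then unique. (iii) For every $c\in(0,1)$, $\bar\rho^\star=\sigma^2/P_a$ is the unique maximizer of $\overline{\mathrm{SINR}}_c$ on $[0,\infty)$. The corresponding parameter $\gamma^\star=P_a/\bar f_c(\sigma^2/P_a)$ is positive and satisfies $\gamma^\star\bar f_c(\bar\rho^\star)=P_a$, and it is the unique maximizer of $\overline{\mathrm{SINR}}_c(\bar\rho)$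 as a function of $\gamma$, where $\bar\rho=\bar\rho(\gamma)$ is the solution in (ii) and $\gamma$ ranges over the values for which it exists. -/

import Mathlib

open MeasureTheory ProbabilityTheory Filter Topology
open scoped Matrix

noncomputable section

namespace SingleRF

/-- The circularly symmetric complex Gaussian law `CN(0, 1)`: real and imaginary part are
independent real Gaussians of variance `1/2`. -/
def complexGaussian : Measure ℂ :=
  ((gaussianReal 0 (1 / 2)).prod (gaussianReal 0 (1 / 2))).map
    (fun p : ℝ × ℝ => (⟨p.1, p.2⟩ : ℂ))

/-- The law `CN(0, I_n)` on `ℂⁿ`. -/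
def stdComplexGaussian (n : ℕ) : Measure (Fin n → ℂ) :=
  Measure.pi fun _ => complexGaussian

/-- The squared Euclidean norm `vᴴ v` of a complex vector. -/
def sqNorm {n : ℕ} (v : Fin n → ℂ) : ℝ := ∑ i, ‖v i‖ ^ 2

/-- The `M × K` channel matrix `H = [h₁, …, h_K]` with columns `h_k`. -/
def channelMatrix {M K : ℕ} (h : Fin K → Fin M → ℂ) : Matrix (Fin M) (Fin K) ℂ :=
  Matrix.of fun i k => h k i

/-- The distortion `‖Hᴴ x - √γ u‖²`. -/
def distortion {M K : ℕ} (H : Matrix (Fin M) (Fin K) ℂ) (γ : ℝ) (u : Fin K → ℂ)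
    (x : Fin M → ℂ) : ℝ :=
  sqNorm (Hᴴ *ᵥ x - ((Real.sqrt γ : ℝ) : ℂ) • u)

/-- `x` solves: minimize `‖Hᴴ x - √γ u‖²` subject to `xᴴ x ≤ Pa`. -/
def IsPrecoding {M K : ℕ} (H : Matrix (Fin M) (Fin K) ℂ) (γ Pa : ℝ) (u : Fin K → ℂ)
    (x : Fin M → ℂ) : Prop :=
  sqNorm x ≤ Pa ∧ ∀ y : Fin M → ℂ, sqNorm y ≤ Pa → distortion H γ u x ≤ distortion H γ u y

/-- The signal-to-interference-plus-noise ratio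
`γ uᴴu / (‖Hᴴ x - √γ u‖² + K σ²)`. -/
def sinr {M K : ℕ} (H : Matrix (Fin M) (Fin K) ℂ) (γ σ : ℝ) (u : Fin K → ℂ)
    (x : Fin M → ℂ) : ℝ :=
  γ * sqNorm u / (distortion H γ u x + K * σ ^ 2)

/-- The function `m(ρ)`, the deterministic equivalent of `(1/K) tr (Hᴴ H / K + ρ I)⁻¹`,
as a function of the ratio `c = K / M`. -/
def mBar (c ρ : ℝ) : ℝ :=
  -2 / (1 - 1 / c - ρ - Real.sqrt ((1 - 1 / c + ρ) ^ 2 + 4 * (1 / c) * ρ))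

/-- `f̄(ρ) = m(ρ) + ρ m'(ρ)`. -/
def fBar (c ρ : ℝ) : ℝ := mBar c ρ + ρ * deriv (mBar c) ρ

/-- `1 / (-ρ² m'(ρ) + (σ² / Pa) f̄(ρ))`. -/
def sinrBar (c σ Pa ρ : ℝ) : ℝ :=
  1 / (-ρ ^ 2 * deriv (mBar c) ρ + σ ^ 2 / Pa * fBar c ρ)

end SingleRF

end

/-! The proof combines Lagrange duality with a distributional recursion for the resolvent. Scaled by
`1 / K`, the minimal distortion is the supremum over `r > 0` of `γ r q(r) - r Pa`, where `q(r) = uᴴ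
(Hᴴ H + r K I)⁻¹ u`. If `q(r)` can be replaced by `m(r)`, the dual objective becomes `γ r m(r) - r
Pa`. Its derivative `γ f̄ - Pa` vanishes at `ρ̄`, and its maximum is `-γ ρ̄² m'(ρ̄)`. Together with
`‖u‖² / K → 1`, this gives the limit of the SINR (`exists_near_dual`, `dual_le_max`,
`tendsto_distortion`, `tendsto_sinr`).

The convergence `q(r) - m(r) → 0` does not use trace lemmas or Stieltjes transforms. By unitary
invariance, `q` has the law of `‖u‖²` times an independent first diagonal entry of the resolvent. By
a Schur complement that entry is `1 / (t (1 + q'))`, where `q'` is a form of the same kind with the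
two dimensions exchanged and one column removed. Two such steps return to the original shape
(`resolventLaw_succ_succ`), and the resulting map contracts towards the root `m(r)` of its
fixed-point equation (`abs_recursion_sub_le`). Finitely many steps, each costing two exponentially
small chi-square deviations, give exponential concentration (`resolventConcentrated`), and
Borel–Cantelli applies whatever the joint law over `K`. Monotonicity of `t q` in `t` extends the
convergence from rational `r` to the random dual multiplier.

Parts (ii) and (iii) are algebra in the coordinate `s = 1 - ρ m(ρ) ∈ (0, 1]`: `f̄` is increasing in
`s²`, and both optimality gaps are multiples of perfect squares. -/

namespace SingleRF

/-! ### Algebra of the deterministic equivalents -/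

section Deterministic

variable {c ρ : ℝ}

lemma discr_pos (hc : 0 < c) (hc1 : c < 1) (hρ : 0 ≤ ρ) :
    0 < (1 - 1 / c + ρ) ^ 2 + 4 * (1 / c) * ρ := by
  have hb : 1 < 1 / c := by rw [lt_div_iff₀ hc]; linarith
  rcases hρ.eq_or_lt with rfl | h
  · have : 1 - 1 / c ≠ 0 := by linarith
    have := sq_pos_of_ne_zero this
    simpa using this
  · positivity

lemma mBar_denom (hc : 0 < c) (hc1 : c < 1) (hρ : 0 ≤ ρ) :
    1 - 1 / c - ρ - √((1 - 1 / c + ρ) ^ 2 + 4 * (1 / c) * ρ) < 0 := by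
  have hb : 1 < 1 / c := by rw [lt_div_iff₀ hc]; linarith
  have := Real.sqrt_nonneg ((1 - 1 / c + ρ) ^ 2 + 4 * (1 / c) * ρ)
  linarith

lemma mBar_pos (hc : 0 < c) (hc1 : c < 1) (hρ : 0 ≤ ρ) : 0 < mBar c ρ :=
  div_pos_of_neg_of_neg (by norm_num) (mBar_denom hc hc1 hρ)

/-- The defining formula is the rationalized root of this quadratic, so it stays meaningful at `ρ =
0`. Dividing the equation by `m` gives the fixed-point equation of the random recursion. -/
lemma mBar_quadratic (hc : 0 < c) (hc1 : c < 1) (hρ : 0 ≤ ρ) :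
    ρ * mBar c ρ ^ 2 + (ρ + 1 / c - 1) * mBar c ρ = 1 := by
  have hd := mBar_denom hc hc1 hρ
  have hw := Real.sq_sqrt (discr_pos hc hc1 hρ).le
  unfold mBar
  generalize √((1 - 1 / c + ρ) ^ 2 + 4 * (1 / c) * ρ) = w at *
  have hd' := hd.ne
  generalize 1 / c = b at *
  field_simp
  linear_combination -hw

lemma hasDerivAt_mBar (hc : 0 < c) (hc1 : c < 1) (hρ : 0 ≤ ρ) :
    HasDerivAt (mBar c)
      (-(mBar c ρ ^ 2 + mBar c ρ) / (2 * ρ * mBar c ρ + ρ + 1 / c - 1)) ρ := by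
  have hd := mBar_denom hc hc1 hρ
  have hp := discr_pos hc hc1 hρ
  have h1 : HasDerivAt (fun r : ℝ => (1 - 1 / c + r) ^ 2 + 4 * (1 / c) * r)
      (2 * (1 - 1 / c + ρ) + 4 * (1 / c)) ρ := by
    have := (((hasDerivAt_id ρ).const_add (1 - 1 / c)).pow 2).add
      ((hasDerivAt_id ρ).const_mul (4 * (1 / c)))
    exact this.congr_deriv (by simp)
  have h2 := ((hasDerivAt_id ρ).const_sub (1 - 1 / c)).sub (h1.sqrt hp.ne')
  have h3 := (hasDerivAt_const ρ (-2 : ℝ)).div h2 hd.ne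
  refine h3.congr_deriv ?_
  have hw := Real.sq_sqrt hp.le
  have hw0 := Real.sqrt_pos.2 hp
  simp only [Pi.sub_apply, id]
  unfold mBar
  generalize √((1 - 1 / c + ρ) ^ 2 + 4 * (1 / c) * ρ) = w at *
  generalize 1 / c = b at *
  have hd' := hd.ne
  -- The denominator produced by implicit differentiation of the quadratic is the square root
  -- itself.
  have e : 2 * ρ * (-2 / (1 - b - ρ - w)) + ρ + b - 1 = w := by
    field_simp
    linear_combination hw
  rw [e]
  field_simp
  ring

/-- The parameter `1 - ρ m(ρ)`, in which all deterministic equivalents are rational. -/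
noncomputable def sBar (c ρ : ℝ) : ℝ := 1 - ρ * mBar c ρ

lemma sBar_mul (hc : 0 < c) (hc1 : c < 1) (hρ : 0 ≤ ρ) :
    sBar c ρ * (1 + mBar c ρ) = 1 / c * mBar c ρ := by
  have := mBar_quadratic hc hc1 hρ
  unfold sBar
  linear_combination -this

lemma sBar_pos (hc : 0 < c) (hc1 : c < 1) (hρ : 0 ≤ ρ) : 0 < sBar c ρ := by
  have h := sBar_mul hc hc1 hρ
  have hm := mBar_pos hc hc1 hρ
  have : 0 < sBar c ρ * (1 + mBar c ρ) := by rw [h]; positivity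
  exact pos_of_mul_pos_left this (by linarith)

lemma sBar_le_one (hc : 0 < c) (hc1 : c < 1) (hρ : 0 ≤ ρ) : sBar c ρ ≤ 1 := by
  have := mul_nonneg hρ (mBar_pos hc hc1 hρ).le
  unfold sBar; linarith

/-- Solved for `ρ`, this inverts the change of variable, `ρ = (1 - s) (1 / c - s) / s`, and makes
every later quantity rational in `s`. -/
lemma mul_sBar (hc : 0 < c) (hc1 : c < 1) (hρ : 0 ≤ ρ) :
    ρ * sBar c ρ = (1 - sBar c ρ) * (1 / c - sBar c ρ) := by
  have := mBar_quadratic hc hc1 hρ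
  unfold sBar
  linear_combination -ρ * this

lemma mBar_eq (hc : 0 < c) (hc1 : c < 1) (hρ : 0 ≤ ρ) :
    mBar c ρ = sBar c ρ / (1 / c - sBar c ρ) := by
  have h := sBar_mul hc hc1 hρ
  have hb : 1 < 1 / c := by rw [lt_div_iff₀ hc]; linarith
  have := sBar_le_one hc hc1 hρ
  rw [eq_div_iff (by linarith)]
  linear_combination -h

lemma deriv_mBar (hc : 0 < c) (hc1 : c < 1) (hρ : 0 ≤ ρ) :
    deriv (mBar c) ρ =
      -(1 / c * sBar c ρ ^ 2) / ((1 / c - sBar c ρ) ^ 2 * (1 / c - sBar c ρ ^ 2)) := by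
  rw [(hasDerivAt_mBar hc hc1 hρ).deriv]
  have hm := mBar_eq hc hc1 hρ
  have h := mul_sBar hc hc1 hρ
  have hs := sBar_pos hc hc1 hρ
  have hs1 := sBar_le_one hc hc1 hρ
  have hb : 1 < 1 / c := by rw [lt_div_iff₀ hc]; linarith
  generalize sBar c ρ = s at *
  generalize mBar c ρ = m at *
  generalize 1 / c = b at *
  have hρ' : ρ = (1 - s) * (b - s) / s := by field_simp; linarith
  have h1 : b - s ≠ 0 := by linarith
  have h2 : b - s ^ 2 ≠ 0 := by nlinarith
  subst hm hρ'
  have e : 2 * ((1 - s) * (b - s) / s) * (s / (b - s)) + (1 - s) * (b - s) / s + b - 1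
      = (b - s ^ 2) / s := by
    field_simp; ring
  rw [e]
  field_simp
  ring

lemma fBar_eq (hc : 0 < c) (hc1 : c < 1) (hρ : 0 ≤ ρ) :
    fBar c ρ = sBar c ρ ^ 2 / (1 / c - sBar c ρ ^ 2) := by
  unfold fBar
  rw [deriv_mBar hc hc1 hρ]
  have hm := mBar_eq hc hc1 hρ
  have h := mul_sBar hc hc1 hρ
  have hs := sBar_pos hc hc1 hρ
  have hs1 := sBar_le_one hc hc1 hρ
  have hb : 1 < 1 / c := by rw [lt_div_iff₀ hc]; linarith
  generalize sBar c ρ = s at *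
  generalize mBar c ρ = m at *
  generalize 1 / c = b at *
  have hρ' : ρ = (1 - s) * (b - s) / s := by field_simp; linarith
  have h1 : b - s ≠ 0 := by linarith
  have h2 : b - s ^ 2 ≠ 0 := by nlinarith
  subst hm hρ'
  field_simp
  ring

lemma neg_sq_mul_deriv_mBar (hc : 0 < c) (hc1 : c < 1) (hρ : 0 ≤ ρ) :
    -ρ ^ 2 * deriv (mBar c) ρ =
      1 / c * (1 - sBar c ρ) ^ 2 / (1 / c - sBar c ρ ^ 2) := by
  rw [deriv_mBar hc hc1 hρ]
  have h := mul_sBar hc hc1 hρ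
  have hs := sBar_pos hc hc1 hρ
  have hs1 := sBar_le_one hc hc1 hρ
  have hb : 1 < 1 / c := by rw [lt_div_iff₀ hc]; linarith
  generalize sBar c ρ = s at *
  generalize 1 / c = b at *
  have hρ' : ρ = (1 - s) * (b - s) / s := by field_simp; linarith
  have h1 : b - s ≠ 0 := by linarith
  have h2 : b - s ^ 2 ≠ 0 := by nlinarith
  subst hρ'
  field_simp

lemma one_div_sub_sq_pos (hc : 0 < c) (hc1 : c < 1) (hρ : 0 ≤ ρ) :
    0 < 1 / c - sBar c ρ ^ 2 := by
  have hs := sBar_pos hc hc1 hρ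
  have hs1 := sBar_le_one hc hc1 hρ
  have hb : 1 < 1 / c := by rw [lt_div_iff₀ hc]; linarith
  nlinarith

lemma fBar_pos (hc : 0 < c) (hc1 : c < 1) (hρ : 0 ≤ ρ) : 0 < fBar c ρ := by
  rw [fBar_eq hc hc1 hρ]
  exact div_pos (pow_pos (sBar_pos hc hc1 hρ) 2) (one_div_sub_sq_pos hc hc1 hρ)

lemma eq_of_sBar_eq (hc : 0 < c) (hc1 : c < 1) {r r' : ℝ} (hr : 0 ≤ r) (hr' : 0 ≤ r')
    (h : sBar c r = sBar c r') : r = r' := by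
  have h1 := mul_sBar hc hc1 hr
  have h2 := mul_sBar hc hc1 hr'
  rw [← h, ← h1] at h2
  exact (mul_right_cancel₀ (sBar_pos hc hc1 hr).ne' h2).symm

lemma fBar_injOn (hc : 0 < c) (hc1 : c < 1) {r r' : ℝ} (hr : 0 ≤ r) (hr' : 0 ≤ r')
    (h : fBar c r = fBar c r') : r = r' := by
  refine eq_of_sBar_eq hc hc1 hr hr' ?_
  rw [fBar_eq hc hc1 hr, fBar_eq hc hc1 hr', div_eq_div_iff
    (one_div_sub_sq_pos hc hc1 hr).ne' (one_div_sub_sq_pos hc hc1 hr').ne'] at h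
  have h2 : 1 / c * (sBar c r ^ 2 - sBar c r' ^ 2) = 0 := by linear_combination h
  have h3 : sBar c r ^ 2 = sBar c r' ^ 2 := by
    have := (mul_eq_zero.1 h2).resolve_left (by positivity)
    linarith
  exact (sq_eq_sq₀ (sBar_pos hc hc1 hr).le (sBar_pos hc hc1 hr').le).1 h3

/-- The quadratic for `s` has roots with product `1 / c > 1`, so at most one of them lies in `(0,
1]`. -/
lemma sBar_of_mul_eq (hc : 0 < c) (hc1 : c < 1) (hρ : 0 ≤ ρ) {s : ℝ} (hs : 0 < s) (hs1 : s ≤ 1)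
    (h : ρ * s = (1 - s) * (1 / c - s)) : sBar c ρ = s := by
  have h1 := mul_sBar hc hc1 hρ
  have ht := sBar_pos hc hc1 hρ
  have ht1 := sBar_le_one hc hc1 hρ
  have hb : 1 < 1 / c := by rw [lt_div_iff₀ hc]; linarith
  generalize sBar c ρ = t at *
  generalize 1 / c = b at *
  have h2 : (t - s) * (b - t * s) = 0 := by linear_combination s * h1 - t * h
  have h3 : b - t * s ≠ 0 := by nlinarith
  have := (mul_eq_zero.1 h2).resolve_right h3
  linarith

/-- The values of `f̄` on `[0, ∞)` are the positive numbers up to `1 / (1 / c - 1)`. -/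
lemma exists_fBar_iff (hc : 0 < c) (hc1 : c < 1) {g Pa : ℝ} (hg : 0 < g) (hPa : 0 < Pa) :
    (∃ r : ℝ, 0 ≤ r ∧ g * fBar c r = Pa) ↔ Pa * (1 / c - 1) ≤ g := by
  have hb : 1 < 1 / c := by rw [lt_div_iff₀ hc]; linarith
  constructor
  · rintro ⟨r, hr, h⟩
    rw [fBar_eq hc hc1 hr] at h
    have hs := sBar_pos hc hc1 hr
    have hs1 := sBar_le_one hc hc1 hr
    have hp := one_div_sub_sq_pos hc hc1 hr
    generalize sBar c r = s at *
    generalize 1 / c = b at *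
    rw [mul_div_assoc', div_eq_iff hp.ne'] at h
    have h2 : s ^ 2 ≤ 1 := by nlinarith
    have h3 : Pa * b ≤ g + Pa := by nlinarith
    linarith
  · intro h
    set b := 1 / c with hbdef
    -- This `s` solves `g s² / (b - s²) = Pa`; the condition `s ≤ 1` is exactly `Pa (b - 1) ≤ g`.
    set s := √(Pa * b / (g + Pa)) with hsdef
    have hq : 0 < Pa * b / (g + Pa) := by positivity
    have hs : 0 < s := Real.sqrt_pos.2 hq
    have hs2 : s ^ 2 = Pa * b / (g + Pa) := Real.sq_sqrt hq.le
    have hs1 : s ≤ 1 := by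
      refine Real.sqrt_le_one.2 ?_
      rw [div_le_one (by positivity)]
      linarith
    have hr : 0 ≤ (1 - s) * (b - s) / s :=
      div_nonneg (mul_nonneg (by linarith) (by linarith)) hs.le
    refine ⟨(1 - s) * (b - s) / s, hr, ?_⟩
    rw [fBar_eq hc hc1 hr, sBar_of_mul_eq hc hc1 hr hs hs1 (by rw [← hbdef]; field_simp), ← hbdef, hs2]
    have : b - Pa * b / (g + Pa) = g * b / (g + Pa) := by field_simp; ring
    rw [this]
    field_simp

lemma sinrBar_eq (hc : 0 < c) (hc1 : c < 1) (hρ : 0 ≤ ρ) (σ Pa : ℝ) :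
    sinrBar c σ Pa ρ = (1 / c - sBar c ρ ^ 2) /
      (1 / c * (1 - sBar c ρ) ^ 2 + σ ^ 2 / Pa * sBar c ρ ^ 2) := by
  have hp := one_div_sub_sq_pos hc hc1 hρ
  unfold sinrBar
  rw [neg_sq_mul_deriv_mBar hc hc1 hρ, fBar_eq hc hc1 hρ, mul_div_assoc', ← add_div, one_div_div]

lemma sinrBar_lt (hc : 0 < c) (hc1 : c < 1) {σ Pa : ℝ} (hσ : 0 < σ) (hPa : 0 < Pa)
    {r : ℝ} (hr : 0 ≤ r) (hne : r ≠ σ ^ 2 / Pa) :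
    sinrBar c σ Pa r < sinrBar c σ Pa (σ ^ 2 / Pa) := by
  have ht : 0 < σ ^ 2 / Pa := by positivity
  rw [sinrBar_eq hc hc1 hr, sinrBar_eq hc hc1 ht.le]
  have hne' : sBar c r ≠ sBar c (σ ^ 2 / Pa) := fun h => hne (eq_of_sBar_eq hc hc1 hr ht.le h)
  have h0 := mul_sBar hc hc1 ht.le
  have hs := sBar_pos hc hc1 hr
  have hs0 := sBar_pos hc hc1 ht.le
  have hp := one_div_sub_sq_pos hc hc1 ht.le
  have h01 : sBar c (σ ^ 2 / Pa) < 1 := by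
    have := mul_pos ht (mBar_pos hc hc1 ht.le)
    unfold sBar; linarith
  have hb : 1 < 1 / c := by rw [lt_div_iff₀ hc]; linarith
  generalize sBar c (σ ^ 2 / Pa) = s₀ at *
  generalize sBar c r = s at *
  generalize 1 / c = b at *
  generalize σ ^ 2 / Pa = t at *
  have ht' : t = (1 - s₀) * (b - s₀) / s₀ := by field_simp; linarith
  -- The value at the candidate is therefore `1 / (1 - s₀)`, and the gap to any other `s` becomes
  -- the square in `key`.
  have e : b * (1 - s₀) ^ 2 + t * s₀ ^ 2 = (1 - s₀) * (b - s₀ ^ 2) := by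
    linear_combination s₀ * h0
  have h1 : 0 < 1 - s₀ := by linarith
  rw [e, div_lt_div_iff₀ (by positivity) (by positivity)]
  have key : b * (1 - s) ^ 2 + t * s ^ 2 - (1 - s₀) * (b - s ^ 2) = b * (s - s₀) ^ 2 / s₀ := by
    rw [ht']; field_simp; ring
  have hpos : 0 < b * (s - s₀) ^ 2 / s₀ := by
    have : 0 < (s - s₀) ^ 2 := sq_pos_of_ne_zero (sub_ne_zero.2 hne')
    positivity
  nlinarith

/-- The concave dual objective attains its maximum where its derivative `γ f̄ - Pa` vanishes. -/
lemma dual_le_max (hc : 0 < c) (hc1 : c < 1) {g Pa r r' : ℝ} (hg : 0 < g)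
    (hr : 0 ≤ r) (hr' : 0 ≤ r') (h : g * fBar c r = Pa) :
    g * (r' * mBar c r') - r' * Pa ≤ g * (-r ^ 2 * deriv (mBar c) r) := by
  rw [neg_sq_mul_deriv_mBar hc hc1 hr, ← h, fBar_eq hc hc1 hr]
  have e : r' * mBar c r' = 1 - sBar c r' := by unfold sBar; ring
  rw [e]
  have h' := mul_sBar hc hc1 hr'
  have hs := sBar_pos hc hc1 hr
  have hs' := sBar_pos hc hc1 hr'
  have hp := one_div_sub_sq_pos hc hc1 hr
  have hb : 0 < 1 / c := by positivity
  generalize sBar c r' = s' at *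
  generalize sBar c r = s at *
  generalize 1 / c = b at *
  have hr'' : r' = (1 - s') * (b - s') / s' := by field_simp; linarith
  -- The duality gap, divided by `g`, is a perfect square over a positive quantity, so no concavity
  -- argument is needed.
  have key : b * (1 - s) ^ 2 / (b - s ^ 2) - ((1 - s') - r' * (s ^ 2 / (b - s ^ 2)))
      = b * (s - s') ^ 2 / (s' * (b - s ^ 2)) := by
    rw [hr'']; field_simp; ring
  have hpos : 0 ≤ b * (s - s') ^ 2 / (s' * (b - s ^ 2)) := by positivity
  have := mul_nonneg hg.le (key ▸ hpos)
  linarith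

lemma dual_eq_max (c g Pa r : ℝ) (h : g * fBar c r = Pa) :
    g * (r * mBar c r) - r * Pa = g * (-r ^ 2 * deriv (mBar c) r) := by
  rw [← h]; unfold fBar; ring

lemma mBar_antitone (hc : 0 < c) (hc1 : c < 1) {r r' : ℝ} (hr : 0 ≤ r) (h : r ≤ r') :
    mBar c r' ≤ mBar c r := by
  by_contra! hlt
  have h1 := mBar_quadratic hc hc1 hr
  have h2 := mBar_quadratic hc hc1 (hr.trans h)
  have hm := mBar_pos hc hc1 hr
  have hb : 1 < 1 / c := by rw [lt_div_iff₀ hc]; linarith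
  have h3 : (r + 1 / c - 1) * mBar c r < (r' + 1 / c - 1) * mBar c r' :=
    mul_lt_mul_of_le_of_lt_of_pos_of_nonneg (by linarith) hlt (by linarith) (by linarith)
  have h4 : r * mBar c r ^ 2 ≤ r' * mBar c r' ^ 2 := by
    have : mBar c r ^ 2 ≤ mBar c r' ^ 2 := by gcongr
    exact mul_le_mul h this (by positivity) (hr.trans h)
  linarith

lemma mul_mBar_le_sqrt (hc : 0 < c) (hc1 : c < 1) (hρ : 0 ≤ ρ) : ρ * mBar c ρ ≤ √ρ := by
  apply Real.le_sqrt_of_sq_le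
  have h := mBar_quadratic hc hc1 hρ
  have hm := mBar_pos hc hc1 hρ
  have hb : 1 < 1 / c := by rw [lt_div_iff₀ hc]; linarith
  have : 0 ≤ (ρ + 1 / c - 1) * mBar c ρ := mul_nonneg (by linarith) hm.le
  nlinarith

/-- A modulus of continuity uniform in both `ρ` and `c`; the uniformity matters because `c = K / M`
varies with `K`. -/
lemma mul_mBar_add_le (hc : 0 < c) (hc1 : c < 1) {d : ℝ} (hρ : 0 ≤ ρ) (hd : 0 ≤ d) :
    (ρ + d) * mBar c (ρ + d) ≤ ρ * mBar c ρ + √d := by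
  have h1 := mul_le_mul_of_nonneg_left (mBar_antitone hc hc1 hρ (le_add_of_nonneg_right hd)) hρ
  have h2 := mul_le_mul_of_nonneg_left (mBar_antitone hc hc1 hd (le_add_of_nonneg_left hρ)) hd
  have h3 := mul_mBar_le_sqrt hc hc1 hd
  linarith

lemma mul_mBar_mono (hc : 0 < c) (hc1 : c < 1) {r r' : ℝ} (hr : 0 ≤ r) (h : r ≤ r') :
    r * mBar c r ≤ r' * mBar c r' := by
  by_contra! hlt
  have h1 := sBar_mul hc hc1 hr
  have h2 := sBar_mul hc hc1 (hr.trans h)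
  have hm := mBar_antitone hc hc1 hr h
  have hm' := mBar_pos hc hc1 (hr.trans h)
  have hs : sBar c r < sBar c r' := by unfold sBar; linarith
  have e1 := mBar_eq hc hc1 hr
  have e2 := mBar_eq hc hc1 (hr.trans h)
  have hb : 1 < 1 / c := by rw [lt_div_iff₀ hc]; linarith
  have hs1 := sBar_le_one hc hc1 (hr.trans h)
  have hs0 := sBar_pos hc hc1 hr
  have : mBar c r < mBar c r' := by
    rw [e1, e2]
    exact div_lt_div₀ hs (by linarith) (by linarith) (by linarith)
  linarith

/-- Since `m' ≤ 0`, `ρ f̄ ≤ ρ m ≤ 1`. This confines `ρ̄` to a bounded interval, where a finite grid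
suffices. -/
lemma mul_le_of_fBar (hc : 0 < c) (hc1 : c < 1) {g Pa : ℝ} (hg : 0 < g) (hρ : 0 ≤ ρ)
    (h : g * fBar c ρ = Pa) : Pa * ρ ≤ g := by
  have hm := mBar_pos hc hc1 hρ
  have hf : fBar c ρ ≤ mBar c ρ := by
    have h1 := neg_sq_mul_deriv_mBar hc hc1 hρ
    have h2 := one_div_sub_sq_pos hc hc1 hρ
    rcases hρ.eq_or_lt with h0 | h0
    · simp [fBar, ← h0]
    have h3 : 0 ≤ ρ * (-(ρ * deriv (mBar c) ρ)) := by
      have : ρ * (-(ρ * deriv (mBar c) ρ)) = -ρ ^ 2 * deriv (mBar c) ρ := by ring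
      rw [this, h1]
      positivity
    have := nonneg_of_mul_nonneg_right h3 h0
    unfold fBar; linarith
  have hs := sBar_pos hc hc1 hρ
  have h4 : ρ * mBar c ρ ≤ 1 := by unfold sBar at hs; linarith
  have h5 : ρ * fBar c ρ ≤ 1 := (mul_le_mul_of_nonneg_left hf hρ).trans h4
  rw [← h]
  nlinarith

end Deterministic

/-! ### Ridge regression, duality and the Schur complement -/

section Resolvent

variable {m n : ℕ}

lemma star_dotProduct_self (v : Fin n → ℂ) : star v ⬝ᵥ v = (sqNorm v : ℂ) := by
  simp only [dotProduct, sqNorm, Pi.star_apply, RCLike.star_def, Complex.ofReal_sum,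
    Complex.ofReal_pow]
  exact Finset.sum_congr rfl fun i _ => Complex.conj_mul' _

lemma sqNorm_nonneg (v : Fin n → ℂ) : 0 ≤ sqNorm v :=
  Finset.sum_nonneg fun _ _ => by positivity

lemma sqNorm_eq_re (v : Fin n → ℂ) : sqNorm v = (star v ⬝ᵥ v).re := by
  rw [star_dotProduct_self, Complex.ofReal_re]

lemma re_star_dotProduct_comm (v w : Fin n → ℂ) :
    (star w ⬝ᵥ v).re = (star v ⬝ᵥ w).re := by
  simp only [dotProduct, Complex.re_sum, Pi.star_apply, RCLike.star_def, Complex.mul_re,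
    Complex.conj_re, Complex.conj_im]
  exact Finset.sum_congr rfl fun i _ => by ring

lemma sqNorm_add (v w : Fin n → ℂ) :
    sqNorm (v + w) = sqNorm v + sqNorm w + 2 * (star v ⬝ᵥ w).re := by
  simp only [sqNorm_eq_re, star_add, add_dotProduct, dotProduct_add, Complex.add_re]
  rw [re_star_dotProduct_comm v w]
  ring

lemma sqNorm_smul (a : ℂ) (v : Fin n → ℂ) : sqNorm (a • v) = ‖a‖ ^ 2 * sqNorm v := by
  simp [sqNorm, Finset.mul_sum, mul_pow]

lemma star_dotProduct_mulVec (H : Matrix (Fin m) (Fin n) ℂ) (x : Fin m → ℂ) (y : Fin n → ℂ) :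
    star x ⬝ᵥ (H *ᵥ y) = star (Hᴴ *ᵥ x) ⬝ᵥ y := by
  rw [Matrix.star_mulVec, Matrix.conjTranspose_conjTranspose, Matrix.dotProduct_mulVec]

/-- The regularized Gram matrix `Hᴴ H + t I`. -/
noncomputable def regGram (t : ℝ) (H : Matrix (Fin m) (Fin n) ℂ) : Matrix (Fin n) (Fin n) ℂ :=
  Hᴴ * H + (t : ℂ) • (1 : Matrix (Fin n) (Fin n) ℂ)

/-- The quadratic form `vᴴ (Hᴴ H + t I)⁻¹ v` of the resolvent. -/
noncomputable def resForm (t : ℝ) (H : Matrix (Fin m) (Fin n) ℂ) (v : Fin n → ℂ) : ℝ :=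
  (star v ⬝ᵥ ((regGram t H)⁻¹ *ᵥ v)).re

lemma regGram_mulVec (t : ℝ) (H : Matrix (Fin m) (Fin n) ℂ) (y : Fin n → ℂ) :
    regGram t H *ᵥ y = Hᴴ *ᵥ (H *ᵥ y) + (t : ℂ) • y := by
  rw [regGram, Matrix.add_mulVec, Matrix.smul_mulVec, Matrix.one_mulVec, Matrix.mulVec_mulVec]

open scoped ComplexOrder in
lemma isUnit_det_regGram {t : ℝ} (ht : 0 < t) (H : Matrix (Fin m) (Fin n) ℂ) :
    IsUnit (regGram t H).det := by
  rw [← Matrix.isUnit_iff_isUnit_det]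
  refine Matrix.PosDef.isUnit (Matrix.PosDef.posSemidef_add
    (Matrix.posSemidef_conjTranspose_mul_self H) ?_)
  exact Matrix.PosDef.smul Matrix.PosDef.one (by exact_mod_cast ht)

lemma regGram_mulVec_inv {t : ℝ} (ht : 0 < t) (H : Matrix (Fin m) (Fin n) ℂ) (v : Fin n → ℂ) :
    regGram t H *ᵥ ((regGram t H)⁻¹ *ᵥ v) = v := by
  rw [Matrix.mulVec_mulVec, Matrix.mul_nonsing_inv _ (isUnit_det_regGram ht H), Matrix.one_mulVec]

lemma eq_inv_mulVec {t : ℝ} (ht : 0 < t) {H : Matrix (Fin m) (Fin n) ℂ} {v y : Fin n → ℂ}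
    (h : regGram t H *ᵥ y = v) : (regGram t H)⁻¹ *ᵥ v = y := by
  rw [← h, Matrix.mulVec_mulVec, Matrix.nonsing_inv_mul _ (isUnit_det_regGram ht H),
    Matrix.one_mulVec]

lemma star_dotProduct_of_regGram_mulVec {t : ℝ} {H : Matrix (Fin m) (Fin n) ℂ}
    {v y : Fin n → ℂ} (h : regGram t H *ᵥ y = v) :
    star v ⬝ᵥ y = ((sqNorm (H *ᵥ y) + t * sqNorm y : ℝ) : ℂ) := by
  rw [← h, regGram_mulVec, star_add, add_dotProduct, ← star_dotProduct_mulVec,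
    star_dotProduct_self]
  simp [star_dotProduct_self]

lemma star_dotProduct_inv {t : ℝ} (ht : 0 < t) (H : Matrix (Fin m) (Fin n) ℂ) (v : Fin n → ℂ) :
    star v ⬝ᵥ ((regGram t H)⁻¹ *ᵥ v) = (resForm t H v : ℂ) := by
  have := star_dotProduct_of_regGram_mulVec (regGram_mulVec_inv ht H v)
  rw [resForm, this, Complex.ofReal_re]

lemma resForm_nonneg {t : ℝ} (ht : 0 < t) (H : Matrix (Fin m) (Fin n) ℂ) (v : Fin n → ℂ) :
    0 ≤ resForm t H v := by
  rw [resForm, star_dotProduct_of_regGram_mulVec (regGram_mulVec_inv ht H v), Complex.ofReal_re]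
  exact add_nonneg (sqNorm_nonneg _) (mul_nonneg ht.le (sqNorm_nonneg _))

lemma resForm_smul (t : ℝ) (H : Matrix (Fin m) (Fin n) ℂ) (a : ℂ) (v : Fin n → ℂ) :
    resForm t H (a • v) = ‖a‖ ^ 2 * resForm t H v := by
  have : star a * a = ((‖a‖ ^ 2 : ℝ) : ℂ) := by
    rw [RCLike.star_def, Complex.conj_mul']; norm_cast
  rw [resForm, resForm, Matrix.mulVec_smul, star_smul, smul_dotProduct, dotProduct_smul,
    smul_smul, this, smul_eq_mul, Complex.re_ofReal_mul]

/-- The minimizer of the Lagrangian `‖Hᴴ x - v‖² + t ‖x‖²`. -/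
noncomputable def ridge (t : ℝ) (H : Matrix (Fin m) (Fin n) ℂ) (v : Fin n → ℂ) : Fin m → ℂ :=
  H *ᵥ ((regGram t H)⁻¹ *ᵥ v)

/-- Completing the square around the ridge solution `H y`: its residual is `-t y` by the normal
equation, so the cross terms cancel. Weak duality and the optimal value of the Lagrangian both
follow. -/
lemma lagrangian_eq {t : ℝ} (ht : 0 < t) (H : Matrix (Fin m) (Fin n) ℂ) (v : Fin n → ℂ)
    (x : Fin m → ℂ) :
    sqNorm (Hᴴ *ᵥ x - v) + t * sqNorm x = t * resForm t H v
      + (sqNorm (Hᴴ *ᵥ (x - ridge t H v)) + t * sqNorm (x - ridge t H v)) := by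
  have hy := regGram_mulVec_inv ht H v
  have hq := star_dotProduct_of_regGram_mulVec hy
  rw [star_dotProduct_inv ht H v] at hq
  have hq' := Complex.ofReal_injective hq
  rw [regGram_mulVec] at hy
  unfold ridge
  generalize (regGram t H)⁻¹ *ᵥ v = y at *
  obtain ⟨d, rfl⟩ : ∃ d, x = d + H *ᵥ y := ⟨x - H *ᵥ y, by simp⟩
  have e1 : Hᴴ *ᵥ (d + H *ᵥ y) - v = Hᴴ *ᵥ d + (-(t : ℂ)) • y := by
    rw [Matrix.mulVec_add, ← hy]
    module
  rw [e1, sqNorm_add, sqNorm_add, sqNorm_smul, hq', add_sub_cancel_right, dotProduct_smul,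
    star_dotProduct_mulVec]
  simp only [norm_neg, Complex.norm_real, smul_eq_mul, neg_mul, Complex.neg_re,
    Complex.re_ofReal_mul, Real.norm_eq_abs, sq_abs]
  ring

lemma mul_resForm_le {t : ℝ} (ht : 0 < t) (H : Matrix (Fin m) (Fin n) ℂ) (v : Fin n → ℂ)
    (x : Fin m → ℂ) :
    t * resForm t H v ≤ sqNorm (Hᴴ *ᵥ x - v) + t * sqNorm x := by
  rw [lagrangian_eq ht]
  have := sqNorm_nonneg (Hᴴ *ᵥ (x - ridge t H v))
  have := mul_nonneg ht.le (sqNorm_nonneg (x - ridge t H v))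
  linarith

lemma lagrangian_ridge {t : ℝ} (ht : 0 < t) (H : Matrix (Fin m) (Fin n) ℂ) (v : Fin n → ℂ) :
    sqNorm (Hᴴ *ᵥ ridge t H v - v) + t * sqNorm (ridge t H v) = t * resForm t H v := by
  rw [lagrangian_eq ht]
  simp [sqNorm]

lemma mul_resForm_le_sqNorm {t : ℝ} (ht : 0 < t) (H : Matrix (Fin m) (Fin n) ℂ)
    (v : Fin n → ℂ) : t * resForm t H v ≤ sqNorm v := by
  have := mul_resForm_le ht H v 0
  simpa [sqNorm] using this

/-- The left side is a minimum over `x` of Lagrangians that increase with `t`. -/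
lemma mul_resForm_mono {t t' : ℝ} (ht : 0 < t) (h : t ≤ t') (H : Matrix (Fin m) (Fin n) ℂ)
    (v : Fin n → ℂ) : t * resForm t H v ≤ t' * resForm t' H v := by
  rw [← lagrangian_ridge (ht.trans_le h)]
  refine (mul_resForm_le ht H v (ridge t' H v)).trans ?_
  have := sqNorm_nonneg (ridge t' H v)
  gcongr

lemma continuous_inv_of_isUnit_det {X : Type*} [TopologicalSpace X]
    {A : X → Matrix (Fin n) (Fin n) ℂ} (hA : Continuous A) (h : ∀ x, IsUnit (A x).det) :
    Continuous fun x => (A x)⁻¹ := by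
  refine continuous_iff_continuousAt.2 fun x => ?_
  refine ContinuousAt.comp (f := A) (g := Inv.inv) (continuousAt_matrix_inv _ ?_)
    hA.continuousAt
  rw [Ring.inverse_eq_inv']
  exact continuousAt_inv₀ (h x).ne_zero

lemma continuous_sqNorm : Continuous (sqNorm : (Fin n → ℂ) → ℝ) := by
  unfold sqNorm; fun_prop

lemma continuousOn_sqNorm_ridge (H : Matrix (Fin m) (Fin n) ℂ) (v : Fin n → ℂ) :
    ContinuousOn (fun t => sqNorm (ridge t H v)) (Set.Ioi 0) := by
  rw [continuousOn_iff_continuous_domRestrict]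
  refine continuous_sqNorm.comp (Continuous.matrix_mulVec continuous_const
    (Continuous.matrix_mulVec (continuous_inv_of_isUnit_det (A := fun t : Set.Ioi (0 : ℝ) =>
      regGram t H) ?_ fun t => isUnit_det_regGram t.2 H) continuous_const))
  unfold regGram
  fun_prop

lemma continuous_channelMatrix :
    Continuous (channelMatrix : (Fin n → Fin m → ℂ) → Matrix (Fin m) (Fin n) ℂ) := by
  unfold channelMatrix
  exact continuous_matrix fun i j => by simp only [Matrix.of_apply]; fun_prop

lemma continuous_resForm {t : ℝ} (ht : 0 < t) :
    Continuous fun p : (Fin n → ℂ) × (Fin n → Fin m → ℂ) =>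
      resForm t (channelMatrix p.2) p.1 := by
  have hH : Continuous fun p : (Fin n → ℂ) × (Fin n → Fin m → ℂ) => channelMatrix p.2 :=
    continuous_channelMatrix.comp continuous_snd
  have hA : Continuous fun p : (Fin n → ℂ) × (Fin n → Fin m → ℂ) =>
      (regGram t (channelMatrix p.2))⁻¹ := by
    refine continuous_inv_of_isUnit_det ?_ fun p => isUnit_det_regGram ht _
    unfold regGram
    exact (hH.matrix_conjTranspose.matrix_mul hH).add continuous_const
  exact Complex.continuous_re.comp
    ((continuous_star.comp continuous_fst).dotProduct (hA.matrix_mulVec continuous_fst))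

/-- Approximate strong duality for least squares under a power constraint. -/
lemma exists_near_dual (H : Matrix (Fin m) (Fin n) ℂ) (v : Fin n → ℂ) {Pa ε : ℝ}
    (hPa : 0 < Pa) (hε : 0 < ε) :
    ∃ t > 0, ∃ x : Fin m → ℂ, sqNorm x ≤ Pa ∧
      sqNorm (Hᴴ *ᵥ x - v) ≤ t * resForm t H v - t * Pa + ε := by
  have h0 : 0 < ε / Pa := by positivity
  -- The multiplier stays positive to keep the resolvent invertible. If `ε / Pa` is already
  -- feasible, complementary slackness fails by at most `t Pa = ε`; otherwise some larger `t` meets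
  -- the power constraint with equality.
  rcases le_or_gt (sqNorm (ridge (ε / Pa) H v)) Pa with h | h
  · refine ⟨ε / Pa, h0, _, h, ?_⟩
    have := lagrangian_ridge h0 H v
    have h1 := mul_nonneg h0.le (sqNorm_nonneg (ridge (ε / Pa) H v))
    have h2 : ε / Pa * Pa = ε := by field_simp
    linarith
  -- Chosen so that `T ‖ridge‖² ≤ ‖v‖² ≤ T Pa`, which makes the upper end feasible.
  · set T := sqNorm v / Pa + ε / Pa with hT
    have hv := sqNorm_nonneg v
    have h0T : ε / Pa ≤ T := le_add_of_nonneg_left (by positivity)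
    have hTpos := h0.trans_le h0T
    have hTle : sqNorm (ridge T H v) ≤ Pa := by
      have h1 := lagrangian_ridge hTpos H v
      have h2 := mul_resForm_le_sqNorm hTpos H v
      have h3 := sqNorm_nonneg (Hᴴ *ᵥ ridge T H v - v)
      have h4 : sqNorm v ≤ T * Pa := by
        rw [hT, add_mul, div_mul_cancel₀ _ hPa.ne', div_mul_cancel₀ _ hPa.ne']; linarith
      exact le_of_mul_le_mul_left (by linarith) hTpos
    obtain ⟨t, ht, hteq⟩ := intermediate_value_Icc' h0T
      ((continuousOn_sqNorm_ridge H v).mono fun t ht => h0.trans_le ht.1)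
      (show Pa ∈ Set.Icc _ _ from ⟨hTle, h.le⟩)
    have ht0 : 0 < t := h0.trans_le ht.1
    refine ⟨t, ht0, ridge t H v, hteq.le, ?_⟩
    have := lagrangian_ridge ht0 H v
    simp only at hteq
    rw [hteq] at this
    linarith

lemma regGram_mul_conjTranspose (t : ℝ) (H : Matrix (Fin m) (Fin n) ℂ)
    {U : Matrix (Fin n) (Fin n) ℂ} (hU : U * Uᴴ = 1) :
    regGram t (H * Uᴴ) = U * regGram t H * Uᴴ := by
  rw [regGram, regGram, Matrix.conjTranspose_mul, Matrix.conjTranspose_conjTranspose, mul_add,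
    add_mul, mul_smul_comm, mul_one, smul_mul_assoc, hU]
  simp only [Matrix.mul_assoc]

lemma resForm_unitary {t : ℝ} (ht : 0 < t) (H : Matrix (Fin m) (Fin n) ℂ)
    {U : Matrix (Fin n) (Fin n) ℂ} (hU : U * Uᴴ = 1) (v : Fin n → ℂ) :
    resForm t (H * Uᴴ) (U *ᵥ v) = resForm t H v := by
  have hU' : Uᴴ * U = 1 := mul_eq_one_comm.1 hU
  have h1 : regGram t (H * Uᴴ) *ᵥ (U *ᵥ ((regGram t H)⁻¹ *ᵥ v)) = U *ᵥ v := by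
    rw [regGram_mul_conjTranspose t H hU, Matrix.mulVec_mulVec, Matrix.mul_assoc _ Uᴴ, hU',
      Matrix.mul_one, ← Matrix.mulVec_mulVec, regGram_mulVec_inv ht]
  rw [resForm, eq_inv_mulVec ht h1, star_dotProduct_mulVec, Matrix.mulVec_mulVec, hU',
    Matrix.one_mulVec, resForm]

/-- The Schur complement step: deleting the first column of `H` and exchanging rows and
columns. -/
lemma resForm_single_zero {t : ℝ} (ht : 0 < t) (h : Fin (n + 1) → Fin m → ℂ) :
    resForm t (channelMatrix h) (Pi.single 0 1) =
      1 / (t * (1 + resForm t (channelMatrix fun i k => h k.succ i) (star (h 0)))) := by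
  set G : Matrix (Fin n) (Fin m) ℂ := channelMatrix fun i k => h k.succ i with hG
  set y := (regGram t G)⁻¹ *ᵥ star (h 0) with hydef
  have hy : Gᴴ *ᵥ (G *ᵥ y) + (t : ℂ) • y = star (h 0) := by
    rw [← regGram_mulVec, hydef, regGram_mulVec_inv ht]
  have hq : h 0 ⬝ᵥ y = (resForm t G (star (h 0)) : ℂ) := by
    rw [← star_dotProduct_inv ht, star_star, hydef]
  have hq0 := resForm_nonneg ht G (star (h 0))
  set q := resForm t G (star (h 0)) with hqdef
  -- The first column of the inverse, up to the factor `t (1 + q)`. `G` is the transpose of `H`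
  -- without its first column, and the equation for `y` gives `H z = t ȳ`, so only the first
  -- coordinate of `(Hᴴ H + t) z` survives.
  set z : Fin (n + 1) → ℂ := Fin.cons 1 (-star (G *ᵥ y)) with hz
  have hHz : channelMatrix h *ᵥ z = (t : ℂ) • star y := by
    have e := congrArg star hy
    rw [star_add, star_star, star_smul] at e
    ext i
    have ei := congrFun e i
    simp only [Pi.add_apply, Pi.star_apply, Pi.smul_apply, smul_eq_mul, RCLike.star_def,
      Complex.conj_ofReal, Matrix.mulVec, dotProduct, map_sum, map_mul,
      Matrix.conjTranspose_apply, Complex.conj_conj, hG, channelMatrix, Matrix.of_apply] at ei ⊢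
    rw [Fin.sum_univ_succ, hz, Fin.cons_zero, mul_one, ← ei]
    simp only [Fin.cons_succ, Pi.neg_apply, Pi.star_apply, Matrix.mulVec,
      dotProduct, channelMatrix, Matrix.of_apply, RCLike.star_def, map_sum, map_mul,
      mul_neg, Finset.sum_neg_distrib, hG]
    ring
  have hAz : regGram t (channelMatrix h) *ᵥ z
      = ((t * (1 + q) : ℝ) : ℂ) • (Pi.single 0 1 : Fin (n + 1) → ℂ) := by
    rw [regGram_mulVec, hHz]
    ext k
    refine Fin.cases ?_ (fun k => ?_) k
    · have e := congrArg (starRingEnd ℂ) hq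
      simp only [dotProduct, map_sum, map_mul, Complex.conj_ofReal] at e
      simp only [Pi.add_apply, Pi.smul_apply, smul_eq_mul, Matrix.mulVec_smul, hz, Fin.cons_zero,
        Matrix.mulVec, dotProduct, Matrix.conjTranspose_apply, channelMatrix, Matrix.of_apply,
        Pi.star_apply, RCLike.star_def, e, Pi.single_eq_same]
      push_cast
      ring
    · simp only [Pi.add_apply, Pi.smul_apply, smul_eq_mul, Matrix.mulVec_smul, hz, Fin.cons_succ,
        Matrix.mulVec, dotProduct, Matrix.conjTranspose_apply, channelMatrix, Matrix.of_apply,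
        Pi.star_apply, RCLike.star_def, Pi.neg_apply, map_sum, map_mul, hG,
        Pi.single_eq_of_ne (Fin.succ_ne_zero k), mul_neg, mul_zero, add_neg_cancel]
  have hs : ((t * (1 + q) : ℝ) : ℂ) ≠ 0 := by
    exact_mod_cast (mul_pos ht (by linarith)).ne'
  have hinv : (regGram t (channelMatrix h))⁻¹ *ᵥ (Pi.single 0 1 : Fin (n + 1) → ℂ)
      = ((t * (1 + q) : ℝ) : ℂ)⁻¹ • z := by
    apply eq_inv_mulVec ht
    rw [Matrix.mulVec_smul, hAz, smul_smul, inv_mul_cancel₀ hs, one_smul]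
  have hstar : star (Pi.single 0 1 : Fin (n + 1) → ℂ) = Pi.single 0 1 := by
    ext k; refine Fin.cases ?_ (fun k => ?_) k <;> simp
  rw [resForm, hinv, hstar, single_dotProduct, one_mul, Pi.smul_apply, smul_eq_mul, hz,
    Fin.cons_zero, mul_one, ← Complex.ofReal_inv, Complex.ofReal_re, one_div]

lemma sqNorm_eq_norm_sq (v : Fin n → ℂ) : sqNorm v = ‖WithLp.toLp 2 v‖ ^ 2 := by
  rw [EuclideanSpace.norm_sq_eq]; rfl

/-- Every vector is mapped to a multiple of the first basis vector by some unitary matrix. -/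
lemma exists_unitary_mulVec (v : Fin (n + 1) → ℂ) :
    ∃ U : Matrix (Fin (n + 1)) (Fin (n + 1)) ℂ, U * Uᴴ = 1 ∧
      U *ᵥ v = ((√(sqNorm v) : ℝ) : ℂ) • (Pi.single 0 1 : Fin (n + 1) → ℂ) := by
  set w : EuclideanSpace ℂ (Fin (n + 1)) := WithLp.toLp 2 v with hw
  have hnorm : √(sqNorm v) = ‖w‖ := by
    rw [sqNorm_eq_norm_sq, Real.sqrt_sq (norm_nonneg _)]
  by_cases h0 : w = 0
  · refine ⟨1, by simp, ?_⟩
    have : v = 0 := by simpa [hw] using h0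
    rw [hnorm, h0, this]
    simp
  have hn : ‖w‖ ≠ 0 := norm_ne_zero_iff.2 h0
  -- The normalized vector is extended to an orthonormal basis, whose conjugates are the rows of
  -- `U`.
  have hortho : Orthonormal ℂ (({0} : Set (Fin (n + 1))).domRestrict
      (fun _ => ((‖w‖ : ℂ)⁻¹ • w))) := by
    refine ⟨fun i => ?_, fun i j hij => absurd (Subsingleton.elim i j) hij⟩
    simp [Set.domRestrict, norm_smul, hn]
  obtain ⟨b, hb⟩ := hortho.exists_orthonormalBasis_extension_of_card_eq
    (by simp)
  have hb0 := hb 0 rfl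
  have hin : ∀ j k, ∑ i, b j i * (starRingEnd ℂ) (b k i) = if k = j then 1 else 0 := by
    intro j k
    have := orthonormal_iff_ite.1 b.orthonormal k j
    rw [PiLp.inner_apply] at this
    simpa using this
  refine ⟨Matrix.of fun j i => (starRingEnd ℂ) (b j i), ?_, ?_⟩
  · ext j k
    rw [Matrix.mul_apply, Matrix.one_apply]
    simp only [Matrix.of_apply, Matrix.conjTranspose_apply, RCLike.star_def, Complex.conj_conj]
    rw [← hin k j]
    exact Finset.sum_congr rfl fun i _ => mul_comm _ _
  · have hv : ∀ i, v i = (‖w‖ : ℂ) * b 0 i := by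
      intro i
      rw [hb0]
      have : (‖w‖ : ℂ) ≠ 0 := by exact_mod_cast hn
      rw [PiLp.smul_apply, smul_eq_mul, mul_inv_cancel_left₀ this]
    ext j
    simp only [Matrix.mulVec, dotProduct, Matrix.of_apply, Pi.smul_apply, smul_eq_mul, hnorm]
    have : ∑ i, (starRingEnd ℂ) (b j i) * v i
        = (‖w‖ : ℂ) * ∑ i, b 0 i * (starRingEnd ℂ) (b j i) := by
      rw [Finset.mul_sum]
      exact Finset.sum_congr rfl fun i _ => by rw [hv]; ring
    rw [this, hin, Pi.single_apply]

end Resolvent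

/-! ### Invariance and concentration of Gaussian vectors -/

section Gaussian

variable {m n : ℕ}

lemma measurable_complexMk : Measurable fun p : ℝ × ℝ => (⟨p.1, p.2⟩ : ℂ) :=
  Complex.measurableEquivRealProd.symm.measurable

instance : IsProbabilityMeasure complexGaussian :=
  Measure.isProbabilityMeasure_map measurable_complexMk.aemeasurable

instance (n : ℕ) : IsProbabilityMeasure (stdComplexGaussian n) := by
  unfold stdComplexGaussian; infer_instance

lemma charFun_complexGaussian (t : ℂ) :
    charFun complexGaussian t = ((Real.exp (-‖t‖ ^ 2 / 4) : ℝ) : ℂ) := by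
  have h1 : ∀ x : ℝ, charFun (gaussianReal 0 (1 / 2)) x = Complex.exp (-x ^ 2 / 4) := by
    intro x
    rw [charFun_gaussianReal]
    congr 1
    push_cast
    ring
  rw [charFun_apply, complexGaussian, integral_map measurable_complexMk.aemeasurable
    (by fun_prop)]
  have h2 : ∀ p : ℝ × ℝ, Complex.exp (((inner ℝ (⟨p.1, p.2⟩ : ℂ) t : ℝ) : ℂ) * Complex.I)
      = Complex.exp (((inner ℝ p.1 t.re : ℝ) : ℂ) * Complex.I)
        * Complex.exp (((inner ℝ p.2 t.im : ℝ) : ℂ) * Complex.I) := by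
    intro p
    rw [← Complex.exp_add, Complex.inner]
    congr 1
    simp
    ring
  simp_rw [h2]
  rw [integral_prod_mul (fun x : ℝ => Complex.exp (((inner ℝ x t.re : ℝ) : ℂ) * Complex.I))
    (fun x : ℝ => Complex.exp (((inner ℝ x t.im : ℝ) : ℂ) * Complex.I)), ← charFun_apply,
    ← charFun_apply, h1, h1, ← Complex.exp_add, Complex.ofReal_exp, Complex.sq_norm,
    Complex.normSq_apply]
  congr 1
  push_cast
  ring

/-- Dependence on `‖t‖` alone is what yields invariance under all real-linear isometries, complex
conjugation included. -/
lemma charFun_stdComplexGaussian (t : PiLp 2 fun _ : Fin n => ℂ) :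
    charFun ((stdComplexGaussian n).map (WithLp.toLp 2)) t
      = ((Real.exp (-‖t‖ ^ 2 / 4) : ℝ) : ℂ) := by
  rw [stdComplexGaussian, charFun_pi]
  simp_rw [charFun_complexGaussian]
  rw [← Complex.ofReal_prod, ← Real.exp_sum, PiLp.norm_sq_eq_of_L2, ← Finset.sum_div,
    Finset.sum_neg_distrib]

lemma continuous_linearEquiv (f : (Fin n → ℂ) ≃ₗ[ℝ] (Fin n → ℂ)) : Continuous f :=
  LinearMap.continuous_of_finiteDimensional f.toLinearMap

/-- The standard complex Gaussian law is invariant under real-linear isometries. -/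
lemma measurePreserving_stdComplexGaussian (f : (Fin n → ℂ) ≃ₗ[ℝ] (Fin n → ℂ))
    (hf : ∀ v, sqNorm (f v) = sqNorm v) :
    MeasurePreserving f (stdComplexGaussian n) (stdComplexGaussian n) := by
  have hfm : Measurable f := (continuous_linearEquiv f).measurable
  refine ⟨hfm, ?_⟩
  let g : (PiLp 2 fun _ : Fin n => ℂ) ≃ₗᵢ[ℝ] (PiLp 2 fun _ : Fin n => ℂ) :=
    { toLinearEquiv := (WithLp.linearEquiv 2 ℝ (Fin n → ℂ)).trans
        (f.trans (WithLp.linearEquiv 2 ℝ (Fin n → ℂ)).symm)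
      norm_map' := fun x => by
        have h := hf (WithLp.ofLp x)
        rw [sqNorm_eq_norm_sq, sqNorm_eq_norm_sq] at h
        exact (sq_eq_sq₀ (norm_nonneg _) (norm_nonneg _)).1 h }
  have hg : ∀ v, WithLp.toLp 2 (f v) = g (WithLp.toLp 2 v) := fun v => rfl
  have hto : Measurable (WithLp.toLp 2 : (Fin n → ℂ) → PiLp 2 fun _ : Fin n => ℂ) :=
    (MeasurableEquiv.toLp 2 (Fin n → ℂ)).measurable
  refine (MeasurableEquiv.toLp 2 (Fin n → ℂ)).map_measurableEquiv_injective
    (Measure.ext_of_charFun (funext fun t => ?_))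
  rw [MeasurableEquiv.coe_toLp]
  have h1 : (((stdComplexGaussian n).map f).map (WithLp.toLp 2))
      = ((stdComplexGaussian n).map (WithLp.toLp 2)).map g := by
    rw [Measure.map_map hto hfm, Measure.map_map g.continuous.measurable hto]
    rfl
  rw [h1, charFun_stdComplexGaussian]
  have h2 : charFun (((stdComplexGaussian n).map (WithLp.toLp 2)).map g) t
      = charFun ((stdComplexGaussian n).map (WithLp.toLp 2)) (g.symm t) := by
    rw [charFun_apply, charFun_apply, integral_map g.continuous.aemeasurable (by fun_prop)]
    refine integral_congr_ae (Eventually.of_forall fun x => ?_)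
    simp only
    rw [LinearIsometryEquiv.inner_map_eq_flip]
  rw [h2, charFun_stdComplexGaussian, LinearIsometryEquiv.norm_map]

lemma measurePreserving_star :
    MeasurePreserving (star : (Fin n → ℂ) → Fin n → ℂ)
      (stdComplexGaussian n) (stdComplexGaussian n) := by
  let f : (Fin n → ℂ) ≃ₗ[ℝ] (Fin n → ℂ) :=
    { toFun := star
      invFun := star
      map_add' := star_add
      map_smul' := fun r v => by ext i; simp
      left_inv := star_star
      right_inv := star_star }
  exact measurePreserving_stdComplexGaussian f fun v => by
    change sqNorm (star v) = sqNorm v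
    simp [sqNorm]

lemma measurePreserving_mulVec {U : Matrix (Fin n) (Fin n) ℂ} (hU : U * Uᴴ = 1) :
    MeasurePreserving (fun v : Fin n → ℂ => U *ᵥ v)
      (stdComplexGaussian n) (stdComplexGaussian n) := by
  have hU' : Uᴴ * U = 1 := mul_eq_one_comm.1 hU
  let f : (Fin n → ℂ) ≃ₗ[ℝ] (Fin n → ℂ) :=
    { toFun := fun v => U *ᵥ v
      invFun := fun v => Uᴴ *ᵥ v
      map_add' := Matrix.mulVec_add U
      map_smul' := fun r v => by
        rw [RingHom.id_apply, Matrix.mulVec_smul]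
      left_inv := fun v => by simp [Matrix.mulVec_mulVec, hU']
      right_inv := fun v => by simp [Matrix.mulVec_mulVec, hU] }
  exact measurePreserving_stdComplexGaussian f fun v => by
    change sqNorm (U *ᵥ v) = sqNorm v
    rw [sqNorm_eq_re, sqNorm_eq_re, star_dotProduct_mulVec, Matrix.mulVec_mulVec, hU',
      Matrix.one_mulVec]

/-- The law of `n` independent columns with law `CN(0, I_m)`. -/
noncomputable def gaussianColumns (n m : ℕ) : Measure (Fin n → Fin m → ℂ) :=
  Measure.pi fun _ => stdComplexGaussian m

instance (n m : ℕ) : IsProbabilityMeasure (gaussianColumns n m) := by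
  unfold gaussianColumns; infer_instance

lemma measurePreserving_transpose (n m : ℕ) :
    MeasurePreserving (fun (h : Fin n → Fin m → ℂ) i k => h k i)
      (gaussianColumns n m) (gaussianColumns m n) := by
  have hcurry : ∀ a b : ℕ, MeasurePreserving (MeasurableEquiv.curry (Fin a) (Fin b) ℂ)
      (Measure.pi fun _ : Fin a × Fin b => complexGaussian) (gaussianColumns a b) := by
    intro a b
    refine ⟨MeasurableEquiv.measurable _, ?_⟩
    have := Measure.infinitePi_map_curry (fun (_ : Fin a) (_ : Fin b) => complexGaussian)
    simp only [Measure.infinitePi_eq_pi] at this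
    exact this
  have hswap := measurePreserving_piCongrLeft
    (fun _ : Fin m × Fin n => complexGaussian) (Equiv.prodComm (Fin n) (Fin m))
  have := ((hcurry m n).comp hswap).comp (hcurry n m).symm
  convert this using 1
  ext h i k
  change h k i = (MeasurableEquiv.piCongrLeft (fun _ => ℂ) (Equiv.prodComm (Fin n) (Fin m)))
    (Function.uncurry h) ((Equiv.prodComm (Fin n) (Fin m)) (k, i))
  rw [MeasurableEquiv.coe_piCongrLeft, Equiv.piCongrLeft_apply_apply]
  rfl

lemma measurePreserving_rows {U : Matrix (Fin n) (Fin n) ℂ} (hU : U * Uᴴ = 1) :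
    MeasurePreserving (fun (h : Fin n → Fin m → ℂ) k i => (U *ᵥ fun l => h l i) k)
      (gaussianColumns n m) (gaussianColumns n m) := by
  have h1 : MeasurePreserving (fun (h : Fin m → Fin n → ℂ) i => U *ᵥ h i)
      (gaussianColumns m n) (gaussianColumns m n) :=
    measurePreserving_pi _ _ fun _ => measurePreserving_mulVec hU
  exact ((measurePreserving_transpose m n).comp h1).comp (measurePreserving_transpose n m)

/-- In law, the quadratic form of the resolvent depends on the vector only through its norm. -/
lemma measure_resForm_eq {t : ℝ} (ht : 0 < t) (v : Fin (n + 1) → ℂ) {B : Set ℝ}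
    (hB : MeasurableSet B) :
    gaussianColumns (n + 1) m {h | resForm t (channelMatrix h) v ∈ B} =
      gaussianColumns (n + 1) m
        {h | sqNorm v * resForm t (channelMatrix h) (Pi.single 0 1) ∈ B} := by
  obtain ⟨U, hU, hUv⟩ := exists_unitary_mulVec v
  -- Conjugated because applying `Ū` across the columns turns `H` into `H Uᴴ`.
  have hU' : U.map (starRingEnd ℂ) * (U.map (starRingEnd ℂ))ᴴ = 1 := by
    have h1 : (U.map (starRingEnd ℂ))ᴴ = Uᴴ.map (starRingEnd ℂ) := by
      ext i j; simp
    rw [h1, ← Matrix.map_mul, hU]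
    ext i j
    by_cases h : i = j <;> simp [Matrix.one_apply, h]
  have hmeas : MeasurableSet
      {h : Fin (n + 1) → Fin m → ℂ | sqNorm v * resForm t (channelMatrix h) (Pi.single 0 1) ∈ B} := by
    have hc : Continuous fun h : Fin (n + 1) → Fin m → ℂ =>
        sqNorm v * resForm t (channelMatrix h) (Pi.single 0 1) :=
      continuous_const.mul ((continuous_resForm ht).comp
        (continuous_const.prodMk continuous_id))
    exact hc.measurable hB
  rw [← (measurePreserving_rows (m := m) hU').measure_preimage hmeas.nullMeasurableSet]
  congr 1
  ext h
  have e : channelMatrix (fun k i => (U.map (starRingEnd ℂ) *ᵥ fun l => h l i) k)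
      = channelMatrix h * Uᴴ := by
    ext i k
    simp [channelMatrix, Matrix.mulVec, dotProduct, Matrix.mul_apply, mul_comm]
  have e2 : resForm t (channelMatrix h * Uᴴ) (U *ᵥ v)
      = sqNorm v * resForm t (channelMatrix h * Uᴴ) (Pi.single 0 1) := by
    rw [hUv, resForm_smul, Complex.norm_real, Real.norm_eq_abs, sq_abs,
      Real.sq_sqrt (sqNorm_nonneg v)]
  simp only [Set.mem_ofPred_eq, Set.preimage_ofPred_eq]
  rw [e, ← e2, resForm_unitary ht _ hU]

lemma integral_exp_mul_sq (t : ℝ) :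
    ∫ x : ℝ, Real.exp (t * x ^ 2) ∂(gaussianReal 0 (1 / 2)) = (√(1 - t))⁻¹ := by
  rw [integral_gaussianReal_eq_integral_smul (by norm_num)]
  have h : ∀ x : ℝ, gaussianPDFReal 0 (1 / 2) x • Real.exp (t * x ^ 2)
      = (√Real.pi)⁻¹ * Real.exp (-(1 - t) * x ^ 2) := by
    intro x
    rw [gaussianPDFReal, smul_eq_mul, mul_assoc, ← Real.exp_add]
    congr 2
    · congr 1
      push_cast
      ring
    · push_cast
      ring
  simp_rw [h]
  rw [integral_const_mul, integral_gaussian, Real.sqrt_div Real.pi_pos.le]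
  have : √Real.pi ≠ 0 := (Real.sqrt_pos.2 Real.pi_pos).ne'
  field_simp

lemma mgf_sqNorm {t : ℝ} (ht : t < 1) :
    mgf sqNorm (stdComplexGaussian n) t = ((1 - t)⁻¹) ^ n := by
  have h1 : ∫ z : ℂ, Real.exp (t * ‖z‖ ^ 2) ∂complexGaussian = (1 - t)⁻¹ := by
    rw [complexGaussian, integral_map measurable_complexMk.aemeasurable (by fun_prop)]
    have h : ∀ p : ℝ × ℝ, Real.exp (t * ‖(⟨p.1, p.2⟩ : ℂ)‖ ^ 2)
        = Real.exp (t * p.1 ^ 2) * Real.exp (t * p.2 ^ 2) := by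
      intro p
      rw [← Real.exp_add, Complex.sq_norm, Complex.normSq_mk]
      ring_nf
    simp_rw [h]
    rw [integral_prod_mul (fun x : ℝ => Real.exp (t * x ^ 2))
      (fun x : ℝ => Real.exp (t * x ^ 2)), integral_exp_mul_sq t, ← mul_inv,
      Real.mul_self_sqrt (by linarith)]
  rw [mgf, stdComplexGaussian]
  have h2 : ∀ v : Fin n → ℂ, Real.exp (t * sqNorm v) = ∏ i, Real.exp (t * ‖v i‖ ^ 2) := by
    intro v
    rw [← Real.exp_sum, sqNorm, Finset.mul_sum]
  simp_rw [h2]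
  rw [integral_fintype_prod_eq_prod (f := fun (_ : Fin n) (z : ℂ) => Real.exp (t * ‖z‖ ^ 2))]
  simp [h1]

/-- This is `-log (1 - t) ≤ t + t²` near `0`: the second-order lower bound on `exp` serves for `t ≥
0`, the first-order one for `t ≤ 0`. -/
lemma inv_one_sub_le_exp {t : ℝ} (ht : |t| ≤ 1 / 3) : (1 - t)⁻¹ ≤ Real.exp (t + t ^ 2) := by
  obtain ⟨h1, h2⟩ := abs_le.1 ht
  rw [inv_le_iff_one_le_mul₀ (by linarith)]
  rcases le_total 0 t with h | h
  · have h3 := Real.quadratic_le_exp_of_nonneg (x := t + t ^ 2) (by positivity)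
    have h4 : 1 ≤ (1 + (t + t ^ 2) + (t + t ^ 2) ^ 2 / 2) * (1 - t) := by
      have : (1 + (t + t ^ 2) + (t + t ^ 2) ^ 2 / 2) * (1 - t) - 1
        = t ^ 2 / 2 * (1 - t - t ^ 2 - t ^ 3) := by ring
      have : 0 ≤ t ^ 2 / 2 * (1 - t - t ^ 2 - t ^ 3) := by
        have h5 : t ^ 2 ≤ 1 / 9 := by nlinarith
        have h6 : t ^ 3 ≤ 1 / 27 := by nlinarith
        exact mul_nonneg (by positivity) (by linarith)
      linarith
    exact h4.trans (mul_le_mul_of_nonneg_right h3 (by linarith))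
  · have h3 := Real.add_one_le_exp (t + t ^ 2)
    have h4 : 1 ≤ (t + t ^ 2 + 1) * (1 - t) := by nlinarith [sq_nonneg t]
    exact h4.trans (mul_le_mul_of_nonneg_right h3 (by linarith))

/-- A non-integrable function would have integral `0` by convention, against the positive value just
computed. -/
lemma integrable_exp_mul_sqNorm {t : ℝ} (ht : t < 1) :
    Integrable (fun v => Real.exp (t * sqNorm v)) (stdComplexGaussian n) := by
  by_contra h
  have h1 := integral_undef h
  have h2 := mgf_sqNorm (n := n) ht
  rw [mgf, h1] at h2
  have : 0 < 1 - t := by linarith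
  have : 0 < ((1 - t)⁻¹) ^ n := by positivity
  linarith

lemma mgf_sqNorm_le {t : ℝ} (ht : |t| ≤ 1 / 3) :
    mgf sqNorm (stdComplexGaussian n) t ≤ Real.exp ((t + t ^ 2) * n) := by
  obtain ⟨h1, h2⟩ := abs_le.1 ht
  rw [mgf_sqNorm (by linarith), mul_comm, Real.exp_nat_mul]
  have : 0 < 1 - t := by linarith
  exact pow_le_pow_left₀ (by positivity) (inv_one_sub_le_exp ht) n

/-- Concentration of the squared norm of a standard complex Gaussian vector. -/
lemma exists_sqNorm_concentration {δ B : ℝ} (hδ : 0 < δ) (hB : 0 < B) :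
    ∃ κ > 0, ∀ (N : ℝ) (n : ℕ), 0 ≤ N → n ≤ B * N →
      (stdComplexGaussian n).real {v | δ * N ≤ |sqNorm v - n|} ≤ 2 * Real.exp (-κ * N) := by
  -- In the Chernoff exponent `t² n - t δ N`, the bound `t B ≤ δ / 2` leaves half of the linear
  -- term.
  set t := min (1 / 3) (δ / (2 * B)) with ht
  have ht0 : 0 < t := by positivity
  have ht3 : t ≤ 1 / 3 := min_le_left _ _
  have htB : t * B ≤ δ / 2 := by
    have := mul_le_mul_of_nonneg_right (min_le_right (1 / 3) (δ / (2 * B))) hB.le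
    rw [← ht] at this
    refine this.trans_eq (by field_simp)
  refine ⟨t * δ / 2, by positivity, fun N n hN hn => ?_⟩
  have hexp : t ^ 2 * n - t * δ * N ≤ -(t * δ / 2) * N := by
    have h1 := mul_le_mul_of_nonneg_left hn (sq_nonneg t)
    have h2 := mul_le_mul_of_nonneg_right htB (mul_nonneg ht0.le hN)
    nlinarith
  have hup : (stdComplexGaussian n).real {v | n + δ * N ≤ sqNorm v}
      ≤ Real.exp (-(t * δ / 2) * N) := by
    refine (measure_ge_le_exp_mul_mgf _ ht0.le (integrable_exp_mul_sqNorm (by linarith))).trans ?_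
    refine (mul_le_mul_of_nonneg_left (mgf_sqNorm_le (by rw [abs_of_pos ht0]; exact ht3))
      (Real.exp_pos _).le).trans ?_
    rw [← Real.exp_add]
    refine Real.exp_le_exp.2 (le_trans (le_of_eq ?_) hexp)
    ring
  have hlo : (stdComplexGaussian n).real {v | sqNorm v ≤ n - δ * N}
      ≤ Real.exp (-(t * δ / 2) * N) := by
    refine (measure_le_le_exp_mul_mgf _ (neg_nonpos.2 ht0.le)
      (integrable_exp_mul_sqNorm (by linarith))).trans ?_
    refine (mul_le_mul_of_nonneg_left (mgf_sqNorm_le (by rw [abs_neg, abs_of_pos ht0]; exact ht3))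
      (Real.exp_pos _).le).trans ?_
    rw [← Real.exp_add]
    refine Real.exp_le_exp.2 (le_trans (le_of_eq ?_) hexp)
    ring
  have hsub : {v : Fin n → ℂ | δ * N ≤ |sqNorm v - n|}
      ⊆ {v | n + δ * N ≤ sqNorm v} ∪ {v | sqNorm v ≤ n - δ * N} := by
    intro v hv
    rcases le_abs.1 (show δ * N ≤ |sqNorm v - n| from hv) with h | h
    · left; rw [Set.mem_ofPred_eq]; linarith
    · right; rw [Set.mem_ofPred_eq]; linarith
  have := (measureReal_mono (μ := stdComplexGaussian n) hsub).trans (measureReal_union_le _ _)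
  linarith

end Gaussian

/-! ### The distributional recursion and its contraction -/

section ResolventLaw

variable {m n : ℕ}

/-- The joint law of a vector and a matrix with independent standard Gaussian entries. -/
noncomputable def gaussianPair (n m : ℕ) : Measure ((Fin n → ℂ) × (Fin n → Fin m → ℂ)) :=
  (stdComplexGaussian n).prod (gaussianColumns n m)

instance (n m : ℕ) : IsProbabilityMeasure (gaussianPair n m) := by
  unfold gaussianPair; infer_instance

/-- The law of `vᴴ (Hᴴ H + t I)⁻¹ v` for independent standard Gaussian `v` and `H`. -/
noncomputable def resolventLaw (t : ℝ) (n m : ℕ) : Measure ℝ :=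
  (gaussianPair n m).map fun p => resForm t (channelMatrix p.2) p.1

/-- The law of the squared norm of a standard Gaussian vector. -/
noncomputable def sqNormLaw (n : ℕ) : Measure ℝ := (stdComplexGaussian n).map sqNorm

instance (n : ℕ) : IsProbabilityMeasure (sqNormLaw n) :=
  Measure.isProbabilityMeasure_map continuous_sqNorm.measurable.aemeasurable

lemma isProbabilityMeasure_resolventLaw {t : ℝ} (ht : 0 < t) (n m : ℕ) :
    IsProbabilityMeasure (resolventLaw t n m) :=
  Measure.isProbabilityMeasure_map (continuous_resForm ht).measurable.aemeasurable

lemma measurePreserving_splitFirst (n m : ℕ) :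
    MeasurePreserving
      (fun h : Fin (n + 1) → Fin m → ℂ =>
        ((star (h 0), fun i k => h k.succ i) : (Fin m → ℂ) × (Fin m → Fin n → ℂ)))
      (gaussianColumns (n + 1) m) (gaussianPair m n) := by
  have h1 := measurePreserving_piFinSuccAbove (fun _ : Fin (n + 1) => stdComplexGaussian m) 0
  have h2 := (measurePreserving_star (n := m)).prod (measurePreserving_transpose n m)
  exact h2.comp h1

lemma map_resForm_single {t : ℝ} (ht : 0 < t) (n m : ℕ) :
    (gaussianColumns (n + 1) m).map (fun h => resForm t (channelMatrix h) (Pi.single 0 1)) =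
      (resolventLaw t m n).map fun q => 1 / (t * (1 + q)) := by
  rw [resolventLaw, Measure.map_map (by fun_prop) (continuous_resForm ht).measurable,
    ← (measurePreserving_splitFirst n m).map_eq, Measure.map_map
      (Measurable.comp (by fun_prop) (continuous_resForm ht).measurable)
      (measurePreserving_splitFirst n m).measurable]
  congr 1
  ext h
  rw [resForm_single_zero ht]
  rfl

/-- Distributional recursion for the quadratic form of the resolvent. -/
lemma resolventLaw_succ {t : ℝ} (ht : 0 < t) (n m : ℕ) :
    resolventLaw t (n + 1) m =
      ((sqNormLaw (n + 1)).prod (resolventLaw t m n)).map fun p => p.1 / (t * (1 + p.2)) := by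
  have := isProbabilityMeasure_resolventLaw ht m n
  have hr : Continuous fun h : Fin (n + 1) → Fin m → ℂ =>
      resForm t (channelMatrix h) (Pi.single 0 1) :=
    (continuous_resForm ht).comp (continuous_const.prodMk continuous_id)
  -- With `v` fixed the two forms agree in law over `H`; integrating over `v` leaves a product of
  -- independent factors.
  have h1 : resolventLaw t (n + 1) m = (gaussianPair (n + 1) m).map
      fun p => sqNorm p.1 * resForm t (channelMatrix p.2) (Pi.single 0 1) := by
    have hm : Measurable fun p : (Fin (n + 1) → ℂ) × (Fin (n + 1) → Fin m → ℂ) =>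
        sqNorm p.1 * resForm t (channelMatrix p.2) (Pi.single 0 1) :=
      ((continuous_sqNorm.comp continuous_fst).mul (hr.comp continuous_snd)).measurable
    ext B hB
    rw [resolventLaw, Measure.map_apply (continuous_resForm ht).measurable hB,
      Measure.map_apply hm hB, gaussianPair,
      Measure.prod_apply ((continuous_resForm ht).measurable hB), Measure.prod_apply (hm hB)]
    exact lintegral_congr fun v => measure_resForm_eq ht v hB
  have h2 : (gaussianPair (n + 1) m).map
      (fun p => sqNorm p.1 * resForm t (channelMatrix p.2) (Pi.single 0 1)) =
      (((sqNormLaw (n + 1)).prod ((gaussianColumns (n + 1) m).map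
        fun h => resForm t (channelMatrix h) (Pi.single 0 1)))).map fun p => p.1 * p.2 := by
    rw [sqNormLaw, Measure.map_prod_map _ _ continuous_sqNorm.measurable hr.measurable,
      Measure.map_map (by fun_prop) (continuous_sqNorm.measurable.prodMap hr.measurable)]
    rfl
  have h3 : (sqNormLaw (n + 1)).prod ((resolventLaw t m n).map fun q => 1 / (t * (1 + q))) =
      ((sqNormLaw (n + 1)).prod (resolventLaw t m n)).map
        (Prod.map id fun q => 1 / (t * (1 + q))) := by
    conv_lhs => rw [← Measure.map_id (μ := sqNormLaw (n + 1))]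
    rw [Measure.map_prod_map _ _ measurable_id (by fun_prop)]
  rw [h1, h2, map_resForm_single ht, h3, Measure.map_map (by fun_prop)
    (measurable_id.prodMap (by fun_prop))]
  congr 1
  ext p
  simp [div_eq_mul_inv]

/-- The recursion applied twice returns to the same shape, with both dimensions reduced. -/
lemma resolventLaw_succ_succ {t : ℝ} (ht : 0 < t) (n m : ℕ) :
    resolventLaw t (n + 1) (m + 1) =
      ((sqNormLaw (n + 1)).prod ((sqNormLaw (m + 1)).prod (resolventLaw t n m))).map
        fun p => p.1 / (t * (1 + p.2.1 / (t * (1 + p.2.2)))) := by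
  have := isProbabilityMeasure_resolventLaw ht n m
  rw [resolventLaw_succ ht, resolventLaw_succ ht]
  have h3 : (sqNormLaw (n + 1)).prod (((sqNormLaw (m + 1)).prod (resolventLaw t n m)).map
        fun p => p.1 / (t * (1 + p.2))) =
      ((sqNormLaw (n + 1)).prod ((sqNormLaw (m + 1)).prod (resolventLaw t n m))).map
        (Prod.map id fun p => p.1 / (t * (1 + p.2))) := by
    conv_lhs => rw [← Measure.map_id (μ := sqNormLaw (n + 1))]
    rw [Measure.map_prod_map _ _ measurable_id (by fun_prop)]
  rw [h3, Measure.map_map (by fun_prop) (measurable_id.prodMap (by fun_prop))]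
  rfl

lemma resolventLaw_neg {t : ℝ} (ht : 0 < t) (n m : ℕ) :
    resolventLaw t n m {q | q < 0} = 0 := by
  rw [resolventLaw, Measure.map_apply (continuous_resForm ht).measurable
    (measurableSet_lt (by fun_prop) (by fun_prop))]
  convert measure_empty (μ := gaussianPair n m)
  ext p
  simpa using resForm_nonneg ht _ _

lemma sqNormLaw_neg (n : ℕ) : sqNormLaw n {q | q < 0} = 0 := by
  rw [sqNormLaw, Measure.map_apply continuous_sqNorm.measurable
    (measurableSet_lt (by fun_prop) (by fun_prop))]
  convert measure_empty (μ := stdComplexGaussian n)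
  ext p
  simpa using sqNorm_nonneg _

/-- The two-step recursion contracts towards its fixed point `μ`. -/
lemma abs_recursion_sub_le {ρ β μ a b q δ e : ℝ} (hρ : 0 < ρ) (hβ : 1 ≤ β) (hμ : 0 ≤ μ)
    (hfix : μ * (ρ * (1 + μ) + β) = 1 + μ) (hb : 0 ≤ b) (hq : 0 ≤ q)
    (haδ : |a - 1| ≤ δ) (hbδ : |b - β| ≤ δ) (hqe : |q - μ| ≤ e) :
    |a / (ρ * (1 + b / (ρ * (1 + q)))) - μ| ≤ 1 / (1 + 2 * ρ) * e + 2 / ρ * δ := by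
  have hδ : 0 ≤ δ := (abs_nonneg _).trans haδ
  have he : 0 ≤ e := (abs_nonneg _).trans hqe
  have hq1 : 0 < 1 + q := by linarith
  have hμ1 : 0 < 1 + μ := by linarith
  have hA : 0 < ρ * (1 + q) + b := by positivity
  have hB : 0 < ρ * (1 + q) + β := by positivity
  have hC : 0 < ρ * (1 + μ) + β := by positivity
  have e0 : a / (ρ * (1 + b / (ρ * (1 + q)))) = a * (1 + q) / (ρ * (1 + q) + b) := by
    field_simp
  have e1 : μ = (1 + μ) / (ρ * (1 + μ) + β) := by rw [eq_div_iff hC.ne', hfix]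
  -- The error is split into the contributions of `a`, `b` and `q`; only the last is inherited from
  -- the preceding stage.
  have d1 : a * (1 + q) / (ρ * (1 + q) + b) - μ
      = (a - 1) * ((1 + q) / (ρ * (1 + q) + b))
        + (β - b) * ((1 + q) / ((ρ * (1 + q) + b) * (ρ * (1 + q) + β)))
        + (q - μ) * (β / ((ρ * (1 + q) + β) * (ρ * (1 + μ) + β))) := by
    calc a * (1 + q) / (ρ * (1 + q) + b) - μ
        = a * (1 + q) / (ρ * (1 + q) + b) - (1 + μ) / (ρ * (1 + μ) + β) := by rw [← e1]
      _ = _ := by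
        field_simp
        ring
  have b1 : (1 + q) / (ρ * (1 + q) + b) ≤ 1 / ρ := by
    rw [div_le_div_iff₀ hA hρ]; nlinarith
  have b2 : (1 + q) / ((ρ * (1 + q) + b) * (ρ * (1 + q) + β)) ≤ 1 / ρ := by
    rw [div_le_div_iff₀ (by positivity) hρ]
    have h1 : (1 + q) * ρ ≤ ρ * (1 + q) + b := by linarith
    have h2 : 1 ≤ ρ * (1 + q) + β := by nlinarith
    nlinarith
  -- The contraction rate: `(ρ + β)² ≥ β (1 + 2 ρ)` because `β ≥ 1`.
  have b3 : β / ((ρ * (1 + q) + β) * (ρ * (1 + μ) + β)) ≤ 1 / (1 + 2 * ρ) := by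
    rw [div_le_div_iff₀ (by positivity) (by positivity)]
    have h1 : ρ + β ≤ ρ * (1 + q) + β := by nlinarith
    have h2 : ρ + β ≤ ρ * (1 + μ) + β := by nlinarith
    have h3 := mul_le_mul h1 h2 (by positivity) hB.le
    nlinarith
  rw [e0, d1]
  refine (abs_add_three _ _ _).trans ?_
  rw [abs_mul, abs_mul, abs_mul, abs_sub_comm β b]
  rw [abs_of_nonneg (show 0 ≤ (1 + q) / (ρ * (1 + q) + b) by positivity),
    abs_of_nonneg (show 0 ≤ (1 + q) / ((ρ * (1 + q) + b) * (ρ * (1 + q) + β)) by positivity),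
    abs_of_nonneg (show 0 ≤ β / ((ρ * (1 + q) + β) * (ρ * (1 + μ) + β)) by positivity)]
  have c1 := mul_le_mul haδ b1 (by positivity) hδ
  have c2 := mul_le_mul hbδ b2 (by positivity) hδ
  have c3 := mul_le_mul hqe b3 (by positivity) he
  have : 2 / ρ * δ = δ * (1 / ρ) + δ * (1 / ρ) := by ring
  linarith

/-- Exponential concentration, up to an error `e`, of the quadratic form of the resolvent around
the fixed point `μ`, uniformly over dimensions `n ≈ N` and `m ≈ β N` with `1 ≤ β ≤ B`. -/
def ResolventConcentrated (ρ B e : ℝ) : Prop :=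
  ∃ C κ η : ℝ, 0 < C ∧ 0 < κ ∧ 0 < η ∧ ∀ (N n m : ℕ) (β μ : ℝ), 0 < N → 1 ≤ β → β ≤ B →
    0 ≤ μ → μ * (ρ * (1 + μ) + β) = 1 + μ → |(n : ℝ) - N| ≤ η * N → |(m : ℝ) - β * N| ≤ η * N →
    (resolventLaw (ρ * N) n m).real {q | e < |q - μ|} ≤ C * Real.exp (-κ * N)

lemma ResolventConcentrated.mono {ρ B e e' : ℝ} (h : ResolventConcentrated ρ B e)
    (hρ : 0 < ρ) (he : e ≤ e') :
    ResolventConcentrated ρ B e' := by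
  obtain ⟨C, κ, η, hC, hκ, hη, h⟩ := h
  refine ⟨C, κ, η, hC, hκ, hη, fun N n m β μ hN h1 h2 h3 h4 h5 h6 => ?_⟩
  have := isProbabilityMeasure_resolventLaw (t := ρ * N) (by positivity) n m
  exact (measureReal_mono fun q hq => he.trans_lt hq).trans (h N n m β μ hN h1 h2 h3 h4 h5 h6)

lemma sqNormLaw_real_le {δ B : ℝ} (hδ : 0 < δ) (hB : 0 < B) :
    ∃ κ > 0, ∀ (N : ℝ) (n : ℕ), 0 ≤ N → n ≤ B * N →
      (sqNormLaw n).real {a | δ * N ≤ |a - n|} ≤ 2 * Real.exp (-κ * N) := by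
  obtain ⟨κ, hκ, h⟩ := exists_sqNorm_concentration hδ hB
  refine ⟨κ, hκ, fun N n hN hn => ?_⟩
  rw [sqNormLaw, map_measureReal_apply continuous_sqNorm.measurable
    (measurableSet_le (by fun_prop) (by fun_prop))]
  exact h N n hN hn

/-- Here `q ≤ ‖v‖² / (ρ N)` and `μ ≤ 1 / ρ`, so an error above `2 / ρ` forces `‖v‖² > 2 N` although
`n ≤ 3 N / 2`. -/
lemma resolventConcentrated_base {ρ : ℝ} (hρ : 0 < ρ) (B : ℝ) :
    ResolventConcentrated ρ B (2 / ρ) := by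
  obtain ⟨κ, hκ, h⟩ := exists_sqNorm_concentration (δ := 1 / 2) (B := 3 / 2) (by norm_num)
    (by norm_num)
  refine ⟨2, κ, 1 / 2, by norm_num, hκ, by norm_num,
    fun N n m β μ hN h1 h2 h3 h4 h5 h6 => ?_⟩
  have hN' : (0 : ℝ) < N := by exact_mod_cast hN
  have ht : 0 < ρ * N := by positivity
  obtain ⟨h5a, h5b⟩ := abs_le.1 h5
  have hμ : μ ≤ 1 / ρ := by
    rw [le_div_iff₀ hρ]
    have : 0 ≤ μ * β := by positivity
    have : (μ * ρ) * (1 + μ) ≤ 1 * (1 + μ) := by nlinarith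
    exact le_of_mul_le_mul_right this (by linarith)
  refine le_trans ?_ (h N n hN'.le (by linarith))
  rw [resolventLaw, map_measureReal_apply (continuous_resForm ht).measurable
    (measurableSet_lt (by fun_prop) (by fun_prop))]
  have hfst : (stdComplexGaussian n).real {v | 1 / 2 * (N : ℝ) ≤ |sqNorm v - n|}
      = (gaussianPair n m).real (Prod.fst ⁻¹' {v | 1 / 2 * (N : ℝ) ≤ |sqNorm v - n|}) := by
    rw [← map_measureReal_apply measurable_fst (measurableSet_le (by fun_prop)
      ((continuous_sqNorm.measurable.sub_const _).abs)), gaussianPair, Measure.map_fst_prod]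
    simp
  rw [hfst]
  refine measureReal_mono fun p hp => ?_
  have hp' : 2 / ρ < |resForm (ρ * N) (channelMatrix p.2) p.1 - μ| := hp
  have hq0 := resForm_nonneg ht (channelMatrix p.2) p.1
  have hq1 := mul_resForm_le_sqNorm ht (channelMatrix p.2) p.1
  change 1 / 2 * (N : ℝ) ≤ |sqNorm p.1 - n|
  have h1ρ : 2 / ρ = 1 / ρ + 1 / ρ := by ring
  have h1ρ' : 0 < 1 / ρ := by positivity
  have hbig : 2 / ρ < resForm (ρ * N) (channelMatrix p.2) p.1 := by
    rcases lt_abs.1 hp' with h | h <;> linarith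
  have : ρ * N * (2 / ρ) < ρ * N * resForm (ρ * N) (channelMatrix p.2) p.1 :=
    mul_lt_mul_of_pos_left hbig ht
  have e : ρ * N * (2 / ρ) = 2 * N := by field_simp
  exact le_trans (by linarith) (le_abs_self _)

lemma ResolventConcentrated.step {ρ B e δ : ℝ} (hρ : 0 < ρ) (hB : 1 ≤ B) (hδ : 0 < δ)
    (h : ResolventConcentrated ρ B e) :
    ResolventConcentrated ρ B (1 / (1 + 2 * ρ) * e + 2 / ρ * δ) := by
  obtain ⟨C, κ, η, hC, hκ, hη, h⟩ := h
  obtain ⟨κ', hκ', hconc⟩ := sqNormLaw_real_le (δ := δ / 2) (B := B + 1) (by positivity)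
    (by positivity)
  set κ₀ := min κ κ' with hκ₀
  -- Halving `η` leaves room for both dimensions to drop by one while `N`, and hence `t = ρ N`,
  -- stays fixed. The bound `1 / 2` keeps the dimensions nonzero, and `δ / 2` controls their
  -- distance from `N` and `β N`.
  set η₀ := min (η / 2) (min (δ / 2) (1 / 2)) with hη₀
  have hκ₀pos : 0 < κ₀ := by positivity
  have hη1 : η₀ ≤ η / 2 := min_le_left _ _
  have hη2 : η₀ ≤ δ / 2 := (min_le_right _ _).trans (min_le_left _ _)
  have hη3 : η₀ ≤ 1 / 2 := (min_le_right _ _).trans (min_le_right _ _)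
  refine ⟨4 + C + Real.exp (κ₀ * (2 / η)), κ₀, η₀, by positivity, hκ₀pos, by positivity,
    fun N n m β μ hN hβ1 hβB hμ hfix hn hm => ?_⟩
  have hN' : (0 : ℝ) < N := by exact_mod_cast hN
  have ht : 0 < ρ * N := by positivity
  have hexp : 0 < Real.exp (-κ₀ * N) := Real.exp_pos _
  have hprob := isProbabilityMeasure_resolventLaw ht n m
  -- When one unit exceeds the room `η N / 2`, the last summand of the constant makes the claimed
  -- bound at least `1`.
  rcases lt_or_ge (N : ℝ) (2 / η) with hsmall | hlarge
  · refine measureReal_le_one.trans ?_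
    have h1 : 1 ≤ Real.exp (κ₀ * (2 / η)) * Real.exp (-κ₀ * N) := by
      rw [← Real.exp_add]
      refine Real.one_le_exp ?_
      have := mul_le_mul_of_nonneg_left hsmall.le hκ₀pos.le
      linarith
    have h2 : 0 ≤ (4 + C) * Real.exp (-κ₀ * N) := by positivity
    linarith
  have hηN : 1 ≤ η / 2 * N := by
    have := mul_le_mul_of_nonneg_left hlarge (half_pos hη).le
    have e1 : η / 2 * (2 / η) = 1 := by field_simp
    linarith
  have hη1N := mul_le_mul_of_nonneg_right hη1 hN'.le
  have hη2N := mul_le_mul_of_nonneg_right hη2 hN'.le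
  have hη3N := mul_le_mul_of_nonneg_right hη3 hN'.le
  have hβN : (N : ℝ) ≤ β * N := le_mul_of_one_le_left hN'.le hβ1
  have hβBN : β * N ≤ B * N := mul_le_mul_of_nonneg_right hβB hN'.le
  obtain ⟨hn1, hn2⟩ := abs_le.1 hn
  obtain ⟨hm1, hm2⟩ := abs_le.1 hm
  have hn0 : n ≠ 0 := by
    rintro rfl
    rw [Nat.cast_zero] at hn1
    linarith
  have hm0 : m ≠ 0 := by
    rintro rfl
    rw [Nat.cast_zero] at hm1
    linarith
  obtain ⟨n, rfl⟩ := Nat.exists_eq_succ_of_ne_zero hn0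
  obtain ⟨m, rfl⟩ := Nat.exists_eq_succ_of_ne_zero hm0
  have hprob' := isProbabilityMeasure_resolventLaw ht n m
  have hind := h N n m β μ hN hβ1 hβB hμ hfix
    (by push_cast at hn1 hn2; rw [abs_le]; constructor <;> linarith)
    (by push_cast at hm1 hm2; rw [abs_le]; constructor <;> linarith)
  have hc1 := hconc N (n + 1) hN'.le (by push_cast at hn2 ⊢; linarith)
  have hc2 := hconc N (m + 1) hN'.le (by push_cast at hm2 ⊢; linarith)
  rw [resolventLaw_succ_succ ht, map_measureReal_apply (by fun_prop)
    (measurableSet_lt (by fun_prop) (by fun_prop))]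
  set Q := (sqNormLaw (n + 1)).prod ((sqNormLaw (m + 1)).prod (resolventLaw (ρ * N) n m)) with hQ
  have m1 : MeasurePreserving Prod.fst Q (sqNormLaw (n + 1)) := measurePreserving_fst
  have m2 : MeasurePreserving (fun p : ℝ × ℝ × ℝ => p.2.1) Q (sqNormLaw (m + 1)) :=
    measurePreserving_fst.comp measurePreserving_snd
  have m3 : MeasurePreserving (fun p : ℝ × ℝ × ℝ => p.2.2) Q (resolventLaw (ρ * N) n m) :=
    measurePreserving_snd.comp measurePreserving_snd
  set A1 : Set (ℝ × ℝ × ℝ) := Prod.fst ⁻¹' {a | δ / 2 * (N : ℝ) ≤ |a - ((n + 1 : ℕ) : ℝ)|}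
  set A2 : Set (ℝ × ℝ × ℝ) :=
    (fun p => p.2.1) ⁻¹' {a | δ / 2 * (N : ℝ) ≤ |a - ((m + 1 : ℕ) : ℝ)|}
  set A3 : Set (ℝ × ℝ × ℝ) := (fun p => p.2.2) ⁻¹' {q | e < |q - μ|}
  set A4 : Set (ℝ × ℝ × ℝ) := (fun p => p.2.1) ⁻¹' {q | q < 0}
  set A5 : Set (ℝ × ℝ × ℝ) := (fun p => p.2.2) ⁻¹' {q | q < 0}
  have r1 : Q.real A1 ≤ 2 * Real.exp (-κ' * N) := by
    rw [m1.measureReal_preimage (measurableSet_le (by fun_prop) (by fun_prop)).nullMeasurableSet]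
    exact hc1
  have r2 : Q.real A2 ≤ 2 * Real.exp (-κ' * N) := by
    rw [m2.measureReal_preimage (measurableSet_le (by fun_prop) (by fun_prop)).nullMeasurableSet]
    exact hc2
  have r3 : Q.real A3 ≤ C * Real.exp (-κ * N) := by
    rw [m3.measureReal_preimage (measurableSet_lt (by fun_prop) (by fun_prop)).nullMeasurableSet]
    exact hind
  have r4 : Q.real A4 = 0 := by
    rw [m2.measureReal_preimage (measurableSet_lt (by fun_prop) (by fun_prop)).nullMeasurableSet,
      measureReal_def, sqNormLaw_neg, ENNReal.toReal_zero]
  have r5 : Q.real A5 = 0 := by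
    rw [m3.measureReal_preimage (measurableSet_lt (by fun_prop) (by fun_prop)).nullMeasurableSet,
      measureReal_def, resolventLaw_neg ht, ENNReal.toReal_zero]
  have hsub : (fun p : ℝ × ℝ × ℝ => p.1 / (ρ * N * (1 + p.2.1 / (ρ * N * (1 + p.2.2))))) ⁻¹'
      {q | 1 / (1 + 2 * ρ) * e + 2 / ρ * δ < |q - μ|} ⊆ A1 ∪ (A2 ∪ (A3 ∪ (A4 ∪ A5))) := by
    intro p hp
    by_contra hcon
    simp only [A1, A2, A3, A4, A5, Set.mem_union, Set.mem_preimage, Set.mem_ofPred_eq, not_or,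
      not_le, not_lt] at hcon hp
    obtain ⟨p1, p2, p3, p4, p5⟩ := hcon
    refine absurd hp (not_lt.2 ?_)
    have e0 : p.1 / (ρ * N * (1 + p.2.1 / (ρ * N * (1 + p.2.2))))
        = p.1 / N / (ρ * (1 + p.2.1 / N / (ρ * (1 + p.2.2)))) := by
      have : 1 + p.2.2 ≠ 0 := by linarith
      field_simp
    rw [e0]
    obtain ⟨q1, q2⟩ := abs_lt.1 p1
    obtain ⟨q3, q4⟩ := abs_lt.1 p2
    refine abs_recursion_sub_le hρ hβ1 hμ hfix (by positivity) p5 ?_ ?_ p3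
    · rw [div_sub_one hN'.ne', abs_div, abs_of_pos hN', div_le_iff₀ hN', abs_le]
      constructor <;> linarith
    · rw [div_sub' hN'.ne', abs_div, abs_of_pos hN', div_le_iff₀ hN', abs_le]
      constructor <;> linarith
  have hu := (measureReal_mono (μ := Q) hsub).trans (measureReal_union_le _ _)
  have hu2 := measureReal_union_le (μ := Q) A2 (A3 ∪ (A4 ∪ A5))
  have hu3 := measureReal_union_le (μ := Q) A3 (A4 ∪ A5)
  have hu4 := measureReal_union_le (μ := Q) A4 A5
  have x1 : Real.exp (-κ' * N) ≤ Real.exp (-κ₀ * N) :=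
    Real.exp_le_exp.2 (mul_le_mul_of_nonneg_right (neg_le_neg (min_le_right _ _)) hN'.le)
  have x2 : C * Real.exp (-κ * N) ≤ C * Real.exp (-κ₀ * N) :=
    mul_le_mul_of_nonneg_left (Real.exp_le_exp.2
      (mul_le_mul_of_nonneg_right (neg_le_neg (min_le_left _ _)) hN'.le)) hC.le
  have x3 : 0 ≤ Real.exp (κ₀ * (2 / η)) * Real.exp (-κ₀ * N) := by positivity
  linarith

/-- Exponential concentration of the quadratic form of the resolvent. -/
lemma resolventConcentrated {ρ B e : ℝ} (hρ : 0 < ρ) (hB : 1 ≤ B) (he : 0 < e) :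
    ResolventConcentrated ρ B e := by
  set r := 1 / (1 + 2 * ρ) with hr
  have hr0 : 0 < r := by positivity
  have hr1 : r < 1 := by rw [hr, div_lt_one (by positivity)]; linarith
  -- Taking `2 δ / ρ = (1 - r) d` makes the slack reproduce itself, `r d + (1 - r) d = d`. The
  -- constants worsen with `k`, but `k` depends only on the target accuracy.
  have key : ∀ k : ℕ, ∀ d > 0, ResolventConcentrated ρ B (2 / ρ * r ^ k + d) := by
    intro k
    induction k with
    | zero =>
      intro d hd
      exact (resolventConcentrated_base hρ B).mono hρ (by simp [hd.le])
    | succ k ih =>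
      intro d hd
      have h1r : 0 < 1 - r := by linarith
      refine ((ih d hd).step hρ hB (δ := ρ / 2 * ((1 - r) * d)) (by positivity)).mono hρ ?_
      rw [← hr]
      have : 2 / ρ * (ρ / 2 * ((1 - r) * d)) = (1 - r) * d := by field_simp
      rw [this, pow_succ]
      exact le_of_eq (by ring)
  have hlim : Tendsto (fun k : ℕ => 2 / ρ * r ^ k) atTop (𝓝 (2 / ρ * 0)) :=
    (tendsto_pow_atTop_nhds_zero_of_lt_one hr0.le hr1).const_mul _
  rw [mul_zero] at hlim
  obtain ⟨k, hk⟩ := (hlim.eventually (gt_mem_nhds (half_pos he))).exists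
  exact (key k (e / 2) (half_pos he)).mono hρ (by linarith)

end ResolventLaw

/-! ### From exponential bounds to almost sure convergence -/

section AlmostSure

variable {Ω : Type*} [MeasurableSpace Ω] {P : Measure Ω} [IsProbabilityMeasure P]

lemma ae_eventually_notMem_of_exp_bound {s : ℕ → Set Ω} {C κ : ℝ} (hκ : 0 < κ)
    (hs : ∀ᶠ K : ℕ in atTop, P.real (s K) ≤ C * Real.exp (-κ * K)) :
    ∀ᵐ ω ∂P, ∀ᶠ K in atTop, ω ∉ s K := by
  have hsum : Summable fun K : ℕ => C * Real.exp (-κ * K) := by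
    refine Summable.mul_left C ?_
    have := Real.summable_exp_nat_mul_iff.2 (neg_neg_of_pos hκ)
    exact this.congr fun K => by rw [mul_comm]
  have h1 : Summable fun K => P.real (s K) := by
    refine hsum.of_norm_bounded_eventually_nat ?_
    filter_upwards [hs] with K hK
    rwa [Real.norm_of_nonneg measureReal_nonneg]
  refine ae_eventually_notMem ?_
  have h2 := h1.tsum_ofReal_ne_top
  simpa [measureReal_def] using h2

lemma ae_tendsto_sub_of_exp_bound {X : ℕ → Ω → ℝ} {a : ℕ → ℝ}
    (h : ∀ e > 0, ∃ C κ : ℝ, 0 < κ ∧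
      ∀ᶠ K : ℕ in atTop, P.real {ω | e < |X K ω - a K|} ≤ C * Real.exp (-κ * K)) :
    ∀ᵐ ω ∂P, Tendsto (fun K => X K ω - a K) atTop (𝓝 0) := by
  have h1 : ∀ j : ℕ, ∀ᵐ ω ∂P, ∀ᶠ K in atTop, ω ∉ {ω | 1 / ((j : ℝ) + 1) < |X K ω - a K|} := by
    intro j
    obtain ⟨C, κ, hκ, hb⟩ := h (1 / ((j : ℝ) + 1)) (by positivity)
    exact ae_eventually_notMem_of_exp_bound hκ hb
  filter_upwards [ae_all_iff.2 h1] with ω hω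
  rw [Metric.tendsto_nhds]
  intro e he
  obtain ⟨j, hj⟩ := exists_nat_one_div_lt he
  filter_upwards [hω j] with K hK
  rw [Real.dist_eq, sub_zero]
  exact lt_of_le_of_lt (not_lt.1 hK) hj

variable {M : ℕ → ℕ} {h : ∀ K : ℕ, Fin K → Ω → (Fin (M K) → ℂ)} {u : ∀ K : ℕ, Ω → (Fin K → ℂ)}

lemma hasLaw_gaussianPair
    (h_law : ∀ K k, HasLaw (h K k) (stdComplexGaussian (M K)) P)
    (h_indep : ∀ K, iIndepFun (h K) P)
    (u_law : ∀ K, HasLaw (u K) (stdComplexGaussian K) P)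
    (hu_indep : ∀ K, IndepFun (fun ω k => h K k ω) (u K) P) (K : ℕ) :
    HasLaw (fun ω => (u K ω, fun k => h K k ω)) (gaussianPair K (M K)) P := by
  have hm : AEMeasurable (fun ω k => h K k ω) P :=
    aemeasurable_pi_lambda _ fun k => (h_law K k).aemeasurable
  refine ⟨(u_law K).aemeasurable.prodMk hm, ?_⟩
  rw [(indepFun_iff_map_prod_eq_prod_map_map (u_law K).aemeasurable hm).1 (hu_indep K).symm,
    (iIndepFun_iff_map_fun_eq_pi_map fun k => (h_law K k).aemeasurable).1 (h_indep K),
    (u_law K).map_eq, gaussianPair, gaussianColumns]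
  simp_rw [(h_law K _).map_eq]

lemma ae_tendsto_resForm (hM : ∀ K, 0 < K → K < M K) {B : ℝ}
    (hB : ∀ᶠ K : ℕ in atTop, (M K : ℝ) ≤ B * K)
    (hlaw : ∀ K, HasLaw (fun ω => (u K ω, fun k => h K k ω)) (gaussianPair K (M K)) P)
    {r : ℝ} (hr : 0 < r) :
    ∀ᵐ ω ∂P, Tendsto (fun K : ℕ => resForm (r * K) (channelMatrix fun k => h K k ω) (u K ω)
      - mBar ((K : ℝ) / (M K : ℝ)) r) atTop (𝓝 0) := by
  refine ae_tendsto_sub_of_exp_bound fun e he => ?_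
  have hB1 : (1 : ℝ) ≤ max 1 B := le_max_left _ _
  obtain ⟨C, κ, η, -, hκ, hη, hbound⟩ := resolventConcentrated hr hB1 he
  refine ⟨C, κ, hκ, ?_⟩
  filter_upwards [hB, eventually_gt_atTop 0] with K hK hK0
  have hK0' : (0 : ℝ) < K := by exact_mod_cast hK0
  have hMK : (K : ℝ) < M K := by exact_mod_cast hM K hK0
  have hc : 0 < (K : ℝ) / M K := div_pos hK0' (hK0'.trans hMK)
  have hc1 : (K : ℝ) / M K < 1 := (div_lt_one (by linarith)).2 hMK
  have ht : 0 < r * K := by positivity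
  have hβ : (M K : ℝ) / K * K = M K := div_mul_cancel₀ _ hK0'.ne'
  have hquad := mBar_quadratic hc hc1 hr.le
  rw [one_div_div] at hquad
  -- With `N = n = K` and `β = M / K = 1 / c`, the fixed point `μ` is `m(r)`.
  have hb := hbound K K (M K) ((M K : ℝ) / K) (mBar ((K : ℝ) / M K) r) hK0
    ((one_le_div hK0').2 hMK.le) ((div_le_iff₀ hK0').2 (hK.trans
      (mul_le_mul_of_nonneg_right (le_max_right _ _) hK0'.le)))
    (mBar_pos hc hc1 hr.le).le (by linear_combination hquad)
    (by simp; positivity) (by rw [hβ]; simp; positivity)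
  have hms : MeasurableSet {q : ℝ | e < |q - mBar ((K : ℝ) / M K) r|} :=
    measurableSet_lt (by fun_prop) (by fun_prop)
  rw [resolventLaw, ← (hlaw K).map_eq, AEMeasurable.map_map_of_aemeasurable
    (continuous_resForm ht).measurable.aemeasurable (hlaw K).aemeasurable,
    map_measureReal_apply_of_aemeasurable
      ((continuous_resForm ht).measurable.comp_aemeasurable (hlaw K).aemeasurable) hms] at hb
  exact hb

lemma ae_tendsto_sqNorm (u_law : ∀ K, HasLaw (u K) (stdComplexGaussian K) P) :
    ∀ᵐ ω ∂P, Tendsto (fun K : ℕ => sqNorm (u K ω) / K - 1) atTop (𝓝 0) := by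
  refine ae_tendsto_sub_of_exp_bound (a := fun _ => 1) fun e he => ?_
  obtain ⟨κ, hκ, hbound⟩ := exists_sqNorm_concentration he one_pos
  refine ⟨2, κ, hκ, ?_⟩
  filter_upwards [eventually_gt_atTop 0] with K hK0
  have hK0' : (0 : ℝ) < K := by exact_mod_cast hK0
  refine le_trans ?_ (hbound K K hK0'.le (by simp))
  rw [← (u_law K).map_eq, map_measureReal_apply_of_aemeasurable (u_law K).aemeasurable
    (measurableSet_le (by fun_prop) (continuous_sqNorm.measurable.sub_const _).abs)]
  refine measureReal_mono fun ω hω => ?_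
  have hω' : e < |sqNorm (u K ω) / K - 1| := hω
  change e * K ≤ |sqNorm (u K ω) - K|
  rw [div_sub_one hK0'.ne', abs_div, abs_of_pos hK0', lt_div_iff₀ hK0'] at hω'
  exact hω'.le

end AlmostSure

/-! ### Passage to the limit in the dual problem -/

section Limit

variable {M : ℕ → ℕ} {γ ρ : ℕ → ℝ} {γ₀ γ₁ Pa : ℝ}
  {H : ∀ K : ℕ, Matrix (Fin (M K)) (Fin K) ℂ} {u : ∀ K : ℕ, Fin K → ℂ}
  {x : ∀ K : ℕ, Fin (M K) → ℂ}

lemma exists_grid {d r : ℝ} (hd : 0 < d) (hr : 0 ≤ r) :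
    ∃ j : ℕ, j ≤ ⌊r / d⌋₊ ∧ r ≤ d * (j + 1) ∧ d * (j + 1) ≤ r + d := by
  refine ⟨⌊r / d⌋₊, le_rfl, ?_, ?_⟩
  · have := (Nat.lt_floor_add_one (r / d)).le
    rwa [div_le_iff₀ hd, mul_comm] at this
  · have := Nat.floor_le (show 0 ≤ r / d by positivity)
    rw [le_div_iff₀ hd] at this
    linarith

lemma resForm_sqrt_smul {m n : ℕ} (t : ℝ) (G : Matrix (Fin m) (Fin n) ℂ) {g : ℝ} (hg : 0 ≤ g)
    (v : Fin n → ℂ) :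
    resForm t G (((√g : ℝ) : ℂ) • v) = g * resForm t G v := by
  rw [resForm_smul, Complex.norm_real, Real.norm_eq_abs, sq_abs, Real.sq_sqrt hg]

/-- Convergence of the resolvent at countably many points gives convergence of the minimal
distortion, by duality and monotonicity. -/
lemma tendsto_distortion (hPa : 0 < Pa) (hM : ∀ K, 0 < K → K < M K) (hγ₀ : 0 < γ₀)
    (hγ : ∀ K, γ₀ ≤ γ K ∧ γ K ≤ γ₁)
    (hρ : ∀ᶠ K : ℕ in atTop, 0 ≤ ρ K ∧ γ K * fBar ((K : ℝ) / (M K : ℝ)) (ρ K) = Pa)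
    (hx : ∀ K, IsPrecoding (H K) (γ K) Pa (u K) (x K))
    (hu : Tendsto (fun K : ℕ => sqNorm (u K) / K - 1) atTop (𝓝 0))
    (hq : ∀ r : ℚ, 0 < r → Tendsto (fun K : ℕ => resForm ((r : ℝ) * K) (H K) (u K)
      - mBar ((K : ℝ) / (M K : ℝ)) r) atTop (𝓝 0)) :
    Tendsto (fun K : ℕ => distortion (H K) (γ K) (u K) (x K) / K
      - γ K * (-(ρ K) ^ 2 * deriv (mBar ((K : ℝ) / (M K : ℝ))) (ρ K))) atTop (𝓝 0) := by
  have hγ₁ : 0 < γ₁ := hγ₀.trans_le ((hγ 0).1.trans (hγ 0).2)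
  rw [Metric.tendsto_nhds]
  intro ε' hε'
  set ε := ε' / (2 * (2 * γ₁ + 2)) with hεdef
  have hε : 0 < ε := by positivity
  have hεε' : (2 * γ₁ + 2) * ε < ε' := by
    have : (2 * γ₁ + 2) * ε = ε' / 2 := by rw [hεdef]; field_simp
    linarith
  -- A rational mesh keeps the grid among the countably many points of convergence; moving by one
  -- mesh costs at most `ε` in `r m(r)` and in `r Pa`.
  obtain ⟨d, hd, hdε, hdPa⟩ : ∃ d : ℚ, 0 < d ∧ √(d : ℝ) ≤ ε ∧ (d : ℝ) * Pa ≤ ε := by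
    obtain ⟨d, hd0, hd⟩ := exists_rat_btwn (show (0 : ℝ) < min (ε ^ 2) (ε / Pa) by positivity)
    refine ⟨d, by exact_mod_cast hd0, ?_, ?_⟩
    · exact Real.sqrt_le_iff.2 ⟨hε.le, hd.le.trans (min_le_left _ _)⟩
    · exact (le_div_iff₀ hPa).1 (hd.le.trans (min_le_right _ _))
  have hd' : (0 : ℝ) < d := by exact_mod_cast hd
  -- Beyond `R` the dual objective is negative once `‖u‖² ≤ 2 K`, so the multiplier needs control
  -- only on `[0, R]`, which also contains `ρ̄`.
  set R := 2 * γ₁ / Pa with hR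
  have hRpos : 0 < R := by positivity
  have hgrid : ∀ᶠ K : ℕ in atTop, ∀ j ∈ Finset.range (⌊R / d⌋₊ + 1),
      |(d * (j + 1) : ℝ) * (resForm ((d * (j + 1) : ℝ) * K) (H K) (u K)
        - mBar ((K : ℝ) / (M K : ℝ)) (d * (j + 1)))| < ε := by
    rw [eventually_all_finset]
    intro j _
    have h1 := (hq (d * (j + 1)) (by positivity)).const_mul (d * (j + 1) : ℝ)
    rw [mul_zero] at h1
    have h2 := h1.abs
    rw [abs_zero] at h2
    have h3 := h2.eventually (gt_mem_nhds hε)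
    push_cast at h3
    exact h3
  have hu2 : ∀ᶠ K : ℕ in atTop, sqNorm (u K) / K - 1 < 1 := hu.eventually (gt_mem_nhds one_pos)
  filter_upwards [hρ, hgrid, hu2, eventually_gt_atTop 0] with K ⟨hρ0, hρeq⟩ hgrid huK hK0
  have hK : (0 : ℝ) < K := by exact_mod_cast hK0
  have hMK : (K : ℝ) < M K := by exact_mod_cast hM K hK0
  have hc : 0 < (K : ℝ) / M K := div_pos hK (hK.trans hMK)
  have hc1 : (K : ℝ) / M K < 1 := (div_lt_one (by linarith)).2 hMK
  have hγK : 0 < γ K := hγ₀.trans_le (hγ K).1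
  have hγK1 := (hγ K).2
  have hγε : γ K * ε ≤ γ₁ * ε := mul_le_mul_of_nonneg_right hγK1 hε.le
  obtain ⟨hxPa, hxmin⟩ := hx K
  have hVeq := dual_eq_max _ _ _ _ hρeq
  have hVmax := fun r' hr' => dual_le_max hc hc1 (r' := r') hγK hρ0 hr' hρeq
  set c := (K : ℝ) / M K with hcdef
  set V := γ K * (-(ρ K) ^ 2 * deriv (mBar c) (ρ K)) with hV
  have hV0 : 0 ≤ V := by simpa using hVmax 0 le_rfl
  have hρR : ρ K ≤ R := by
    have h1 := mul_le_of_fBar hc hc1 hγK hρ0 hρeq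
    rw [hR, le_div_iff₀ hPa]
    linarith
  have point : ∀ r : ℝ, 0 ≤ r → r ≤ R → ∃ s : ℝ, 0 < s ∧ r ≤ s ∧ s ≤ r + d ∧
      |s * resForm (s * K) (H K) (u K) - s * mBar c s| < ε := by
    intro r hr hrR
    obtain ⟨j, hj, h1, h2⟩ := exists_grid hd' hr
    refine ⟨d * (j + 1), by positivity, h1, h2, ?_⟩
    rw [← mul_sub]
    exact hgrid j (Finset.mem_range_succ_iff.2
      (hj.trans (Nat.floor_le_floor (div_le_div_of_nonneg_right hrR hd'.le))))
  -- The near-optimal multiplier is uncontrolled, hence the case split at `R` and the comparison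
  -- with the grid point just above it.
  have upper : distortion (H K) (γ K) (u K) (x K) / K ≤ V + (2 * γ₁ + 2) * ε := by
    obtain ⟨t, ht, y, hyPa, hy⟩ := exists_near_dual (H K) (((√(γ K) : ℝ) : ℂ) • u K) hPa
      (ε := ε * K) (by positivity)
    have h1 := (hxmin y hyPa).trans hy
    rw [resForm_sqrt_smul _ _ hγK.le] at h1
    set r := t / K with hr
    have htr : t = r * K := by rw [hr, div_mul_cancel₀ _ hK.ne']
    have hr0 : 0 < r := by positivity
    have h2 : distortion (H K) (γ K) (u K) (x K) / K
        ≤ γ K * (r * resForm (r * K) (H K) (u K)) - r * Pa + ε := by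
      rw [div_le_iff₀ hK]
      refine h1.trans (le_of_eq ?_)
      rw [htr]; ring
    rcases le_or_gt r R with hrR | hrR
    · obtain ⟨s, hs0, hrs, hsr, hs⟩ := point r hr0.le hrR
      have h3 : r * resForm (r * K) (H K) (u K) ≤ s * resForm (s * K) (H K) (u K) := by
        have h4 := mul_resForm_mono (mul_pos hr0 hK) (mul_le_mul_of_nonneg_right hrs hK.le)
          (H K) (u K)
        refine le_of_mul_le_mul_right ?_ hK
        linarith
      have h5 : s * mBar c s ≤ r * mBar c r + ε := by
        have h6 := mul_mBar_mono hc hc1 hs0.le hsr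
        have h7 := mul_mBar_add_le hc hc1 hr0.le hd'.le
        linarith
      have h8 := (abs_lt.1 hs).2
      have h9 : r * resForm (r * K) (H K) (u K) ≤ r * mBar c r + 2 * ε := by linarith
      have h10 := mul_le_mul_of_nonneg_left h9 hγK.le
      have h11 := hVmax r hr0.le
      linarith
    · have h3 : r * resForm (r * K) (H K) (u K) ≤ 2 := by
        have h4 := mul_resForm_le_sqNorm (mul_pos hr0 hK) (H K) (u K)
        have h5 : sqNorm (u K) ≤ 2 * K := (div_le_iff₀ hK).1 (by linarith)
        refine le_of_mul_le_mul_right ?_ hK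
        linarith
      have h6 : γ K * (r * resForm (r * K) (H K) (u K)) ≤ γ₁ * 2 :=
        (mul_le_mul_of_nonneg_left h3 hγK.le).trans
          (mul_le_mul_of_nonneg_right hγK1 (by norm_num))
      have h7 : 2 * γ₁ < r * Pa := (div_lt_iff₀ hPa).1 hrR
      have h8 : 0 ≤ γ₁ * ε := by positivity
      linarith
  -- Weak duality at a grid point just above `ρ̄` is enough.
  have lower : V - (2 * γ₁ + 2) * ε ≤ distortion (H K) (γ K) (u K) (x K) / K := by
    obtain ⟨s, hs0, hrs, hsr, hs⟩ := point (ρ K) hρ0 hρR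
    have h1 := mul_resForm_le (mul_pos hs0 hK) (H K) (((√(γ K) : ℝ) : ℂ) • u K) (x K)
    rw [resForm_sqrt_smul _ _ hγK.le] at h1
    have h2 : s * K * sqNorm (x K) ≤ s * K * Pa :=
      mul_le_mul_of_nonneg_left hxPa (by positivity)
    have h3 : γ K * (s * resForm (s * K) (H K) (u K)) - s * Pa
        ≤ distortion (H K) (γ K) (u K) (x K) / K := by
      rw [le_div_iff₀ hK]
      unfold distortion
      linarith
    have h4 := mul_mBar_mono hc hc1 hρ0 hrs
    have h5 := (abs_lt.1 hs).1
    have h6 : ρ K * mBar c (ρ K) - ε ≤ s * resForm (s * K) (H K) (u K) := by linarith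
    have h7 := mul_le_mul_of_nonneg_left h6 hγK.le
    have h8 : s * Pa ≤ ρ K * Pa + ε := by
      have := mul_le_mul_of_nonneg_right hsr hPa.le
      linarith
    have h9 : 0 ≤ γ₁ * ε := by positivity
    linarith
  rw [Real.dist_eq, sub_zero, abs_lt]
  constructor <;> linarith

/-- The relation `γ f̄ = Pa` turns the limit into `γ / (V + σ²)`, with `V` the limiting distortion;
both denominators are at least `σ²`, so the quotients differ by a Lipschitz bound. -/
lemma tendsto_sinr (hPa : 0 < Pa) {σ : ℝ} (hσ : 0 < σ) (hM : ∀ K, 0 < K → K < M K)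
    (hγ₀ : 0 < γ₀) (hγ : ∀ K, γ₀ ≤ γ K ∧ γ K ≤ γ₁)
    (hρ : ∀ᶠ K : ℕ in atTop, 0 ≤ ρ K ∧ γ K * fBar ((K : ℝ) / (M K : ℝ)) (ρ K) = Pa)
    (hu : Tendsto (fun K : ℕ => sqNorm (u K) / K - 1) atTop (𝓝 0))
    (hD : Tendsto (fun K : ℕ => distortion (H K) (γ K) (u K) (x K) / K
      - γ K * (-(ρ K) ^ 2 * deriv (mBar ((K : ℝ) / (M K : ℝ))) (ρ K))) atTop (𝓝 0)) :
    Tendsto (fun K : ℕ => sinr (H K) (γ K) σ (u K) (x K)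
      - sinrBar ((K : ℝ) / (M K : ℝ)) σ Pa (ρ K)) atTop (𝓝 0) := by
  have hγ₁ : 0 < γ₁ := hγ₀.trans_le ((hγ 0).1.trans (hγ 0).2)
  have hb : Tendsto (fun K : ℕ => γ₁ * |sqNorm (u K) / K - 1| / σ ^ 2
      + γ₁ * |distortion (H K) (γ K) (u K) (x K) / K
        - γ K * (-(ρ K) ^ 2 * deriv (mBar ((K : ℝ) / (M K : ℝ))) (ρ K))| / (σ ^ 2 * σ ^ 2))
      atTop (𝓝 0) := by
    have := ((hu.abs.const_mul γ₁).div_const (σ ^ 2)).add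
      ((hD.abs.const_mul γ₁).div_const (σ ^ 2 * σ ^ 2))
    simpa using this
  refine squeeze_zero_norm' ?_ hb
  filter_upwards [hρ, eventually_gt_atTop 0] with K ⟨hρ0, hρeq⟩ hK0
  have hK : (0 : ℝ) < K := by exact_mod_cast hK0
  have hMK : (K : ℝ) < M K := by exact_mod_cast hM K hK0
  have hc : 0 < (K : ℝ) / M K := div_pos hK (hK.trans hMK)
  have hc1 : (K : ℝ) / M K < 1 := (div_lt_one (by linarith)).2 hMK
  have hγK : 0 < γ K := hγ₀.trans_le (hγ K).1
  have hγK1 := (hγ K).2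
  have hV0 : 0 ≤ γ K * (-(ρ K) ^ 2 * deriv (mBar ((K : ℝ) / (M K : ℝ))) (ρ K)) := by
    simpa using dual_le_max hc hc1 hγK hρ0 le_rfl hρeq
  have hX0 : 0 ≤ distortion (H K) (γ K) (u K) (x K) / K :=
    div_nonneg (sqNorm_nonneg _) hK.le
  have e1 : sinr (H K) (γ K) σ (u K) (x K)
      = γ K * (sqNorm (u K) / K) / (distortion (H K) (γ K) (u K) (x K) / K + σ ^ 2) := by
    unfold sinr
    rw [div_add' _ _ _ hK.ne', mul_div_assoc', div_div_div_cancel_right₀ hK.ne', mul_comm (σ ^ 2)]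
  have e2 : sinrBar ((K : ℝ) / (M K : ℝ)) σ Pa (ρ K)
      = γ K / (γ K * (-(ρ K) ^ 2 * deriv (mBar ((K : ℝ) / (M K : ℝ))) (ρ K)) + σ ^ 2) := by
    have hf : fBar ((K : ℝ) / (M K : ℝ)) (ρ K) = Pa / γ K := by
      rw [eq_div_iff hγK.ne', ← hρeq, mul_comm]
    unfold sinrBar
    rw [hf]
    have : σ ^ 2 / Pa * (Pa / γ K) = σ ^ 2 / γ K := by field_simp
    rw [this, add_div' _ _ _ hγK.ne', one_div_div]
    congr 2
    ring
  rw [e1, e2]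
  generalize γ K * (-(ρ K) ^ 2 * deriv (mBar ((K : ℝ) / (M K : ℝ))) (ρ K)) = V at *
  generalize distortion (H K) (γ K) (u K) (x K) / K = X at *
  generalize sqNorm (u K) / K = a at *
  have hs : 0 < σ ^ 2 := by positivity
  have hXs : 0 < X + σ ^ 2 := by linarith
  have hVs : 0 < V + σ ^ 2 := by linarith
  have e3 : γ K * a / (X + σ ^ 2) - γ K / (V + σ ^ 2)
      = γ K * (a - 1) / (X + σ ^ 2) - γ K * (X - V) / ((X + σ ^ 2) * (V + σ ^ 2)) := by
    field_simp
    ring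
  rw [Real.norm_eq_abs, e3]
  refine (abs_sub _ _).trans (add_le_add ?_ ?_)
  · rw [abs_div, abs_mul, abs_of_pos hγK, abs_of_pos hXs]
    have h1 : γ K * |a - 1| ≤ γ₁ * |a - 1| := mul_le_mul_of_nonneg_right hγK1 (abs_nonneg _)
    exact div_le_div₀ (by positivity) h1 hs (by linarith)
  · rw [abs_div, abs_mul, abs_of_pos hγK, abs_of_pos (mul_pos hXs hVs)]
    have h1 : γ K * |X - V| ≤ γ₁ * |X - V| := mul_le_mul_of_nonneg_right hγK1 (abs_nonneg _)
    exact div_le_div₀ (by positivity) h1 (by positivity)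
      (mul_le_mul (by linarith) (by linarith) hs.le hXs.le)

end Limit

end SingleRF

theorem proposition5
    {Ω : Type*} [MeasurableSpace Ω] (P : Measure Ω) [IsProbabilityMeasure P]
    (σ Pa : ℝ) (hσ : 0 < σ) (hPa : 0 < Pa)
    (M : ℕ → ℕ) (hM : ∀ K, 0 < K → K < M K)
    (γ : ℕ → ℝ) (γ₀ γ₁ : ℝ) (hγ₀ : 0 < γ₀) (hγ : ∀ K, γ₀ ≤ γ K ∧ γ K ≤ γ₁)
    (h : ∀ K : ℕ, Fin K → Ω → (Fin (M K) → ℂ))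
    (u : ∀ K : ℕ, Ω → (Fin K → ℂ))
    (h_law : ∀ K k, HasLaw (h K k) (SingleRF.stdComplexGaussian (M K)) P)
    (h_indep : ∀ K, iIndepFun (h K) P)
    (u_law : ∀ K, HasLaw (u K) (SingleRF.stdComplexGaussian K) P)
    (hu_indep : ∀ K, IndepFun (fun ω k => h K k ω) (u K) P)
    (x : ∀ K : ℕ, Ω → (Fin (M K) → ℂ))
    (hx : ∀ K, ∀ᵐ ω ∂P, SingleRF.IsPrecoding
      (SingleRF.channelMatrix fun k => h K k ω) (γ K) Pa (u K ω) (x K ω))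
    (ρ : ℕ → ℝ)
    (hρ : ∀ᶠ K : ℕ in atTop, 0 ≤ ρ K ∧ γ K * SingleRF.fBar ((K : ℝ) / (M K : ℝ)) (ρ K) = Pa) :
    -- the deterministic equivalent of the SINR
    (∀ᵐ ω ∂P, Tendsto
      (fun K : ℕ =>
        SingleRF.sinr (SingleRF.channelMatrix fun k => h K k ω) (γ K) σ (u K ω) (x K ω)
          - SingleRF.sinrBar ((K : ℝ) / (M K : ℝ)) σ Pa (ρ K))
      atTop (𝓝 0)) ∧
    ∀ c : ℝ, 0 < c → c < 1 →
      -- for which design parameters the parameter `ρ` exists (it is then unique)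
      (∀ g : ℝ, 0 < g →
        ((∃ r : ℝ, 0 ≤ r ∧ g * SingleRF.fBar c r = Pa) ↔ Pa * (1 / c - 1) ≤ g) ∧
        ∀ r r' : ℝ, 0 ≤ r → 0 ≤ r' → g * SingleRF.fBar c r = Pa →
          g * SingleRF.fBar c r' = Pa → r = r') ∧
      -- the unique maximizer over `ρ`
      (∀ r : ℝ, 0 ≤ r → r ≠ σ ^ 2 / Pa →
        SingleRF.sinrBar c σ Pa r < SingleRF.sinrBar c σ Pa (σ ^ 2 / Pa)) ∧
      -- the unique maximizer over `γ`
      0 < Pa / SingleRF.fBar c (σ ^ 2 / Pa) ∧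
      (Pa / SingleRF.fBar c (σ ^ 2 / Pa)) * SingleRF.fBar c (σ ^ 2 / Pa) = Pa ∧
      (∀ g r : ℝ, 0 < g → 0 ≤ r → g * SingleRF.fBar c r = Pa →
        g ≠ Pa / SingleRF.fBar c (σ ^ 2 / Pa) →
        SingleRF.sinrBar c σ Pa r < SingleRF.sinrBar c σ Pa (σ ^ 2 / Pa)) := by
  refine ⟨?_, fun c hc hc1 => ?_⟩
  · have hlaw := SingleRF.hasLaw_gaussianPair h_law h_indep u_law hu_indep
    -- Boundedness of `M / K` is not assumed: solvability for `ρ̄` forces `M / K - 1 ≤ γ / Pa`.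
    have hB : ∀ᶠ K : ℕ in atTop, (M K : ℝ) ≤ (γ₁ / Pa + 1) * K := by
      filter_upwards [hρ, eventually_gt_atTop 0] with K hK hK0
      have hK0' : (0 : ℝ) < K := by exact_mod_cast hK0
      have hMK : (K : ℝ) < M K := by exact_mod_cast hM K hK0
      have h1 := (SingleRF.exists_fBar_iff (div_pos hK0' (hK0'.trans hMK))
        ((div_lt_one (hK0'.trans hMK)).2 hMK) (hγ₀.trans_le (hγ K).1) hPa).1 ⟨ρ K, hK⟩
      rw [one_div_div] at h1
      rw [← div_le_iff₀ hK0', ← sub_le_iff_le_add, le_div_iff₀ hPa, mul_comm]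
      exact h1.trans (hγ K).2
    have hq : ∀ r : ℚ, ∀ᵐ ω ∂P, 0 < r → Tendsto (fun K : ℕ =>
        SingleRF.resForm ((r : ℝ) * K) (SingleRF.channelMatrix fun k => h K k ω) (u K ω)
          - SingleRF.mBar ((K : ℝ) / (M K : ℝ)) r) atTop (𝓝 0) := by
      intro r
      by_cases hr : 0 < r
      · filter_upwards [SingleRF.ae_tendsto_resForm hM hB hlaw
          (show (0 : ℝ) < r by exact_mod_cast hr)] with ω hω _
        exact hω
      · exact Eventually.of_forall fun ω h0 => absurd h0 hr
    filter_upwards [ae_all_iff.2 hq, ae_all_iff.2 hx, SingleRF.ae_tendsto_sqNorm u_law]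
      with ω hqω hxω huω
    exact SingleRF.tendsto_sinr hPa hσ hM hγ₀ hγ hρ huω
      (SingleRF.tendsto_distortion hPa hM hγ₀ hγ hρ hxω huω hqω)
  · have ht : 0 < σ ^ 2 / Pa := by positivity
    have hf := SingleRF.fBar_pos hc hc1 ht.le
    refine ⟨fun g hg => ⟨SingleRF.exists_fBar_iff hc hc1 hg hPa, fun r r' hr hr' h1 h2 => ?_⟩,
      fun r hr hne => SingleRF.sinrBar_lt hc hc1 hσ hPa hr hne, div_pos hPa hf,
      div_mul_cancel₀ _ hf.ne', fun g r _ hr hgr hne => ?_⟩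
    · exact SingleRF.fBar_injOn hc hc1 hr hr' (mul_left_cancel₀ hg.ne' (h1.trans h2.symm))
    -- The constraint recovers `g` from `r`, so a different `g` means a different `r`.
    · refine SingleRF.sinrBar_lt hc hc1 hσ hPa hr fun h0 => hne ?_
      rw [eq_div_iff hf.ne', ← h0, hgr]
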